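/- Fix $d\ge 1$ and $\lambda>0$. Let $W\sim\mathrm{GOE}(d)$, that is, $W$ is symmetric, its entries $W_{ij}$, $i\le j$, are independent, $W_{ij}\sim\mathcal N(0,1)$ for $i<j$ and $W_{ii}\sim\mathcal N(0,2)$. For $u$ in the unit sphere $\mathcal S^{d-1}\subset\mathbb R^d$ let $\Pr_u$ be the law of $M=\lambda uu^\top+\frac1{\sqrt d}W$. A (randomized, adaptive) $T$-query algorithm makes queries $v^{(1)},\dots,v^{(T)}\in\mathbb R^d$ to an unknown symmetric matrix $M$, receives the noiseless responses $w^{(i)}=Mv^{(i)}$, and returns a unit vector $\widehat v=v^{(T+1)}$. For each $1\le i\le T+1$, $v^{(i)}$ is a measurable function of $(v^{(j)},w^{(j)})_{j<i}$ and of a random seed that is independent of $M$ and of the prior draw below. (Deterministic algorithms are a special case.) $\Pr_u$ and $\mathbb E_{\Pr_u}$ also refer to the run of the algorithm on $M\sim\Pr_u$. Let $\mathcal P$ be a probability distribution on $\mathcal S^{d-1}$ that is isotropic, $\mathbb E_{\theta\sim\mathcal P}[\theta\theta^\top]=\frac1d I$, and satisfies, for constants $C_1,C_2>0$ and all $t\ge0$,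 $$\sup_{v\in\mathcal S^{d-1}}\Pr_{u\sim\mathcal P}\left[d\langle v,u\rangle^2\ge t\right]\le e^{C_2-C_1t}.$$ Given an algorithm, put $\tau_i:=\mathbb E_{u\sim\mathcal P}\mathbb E_{\Pr_u}[d\langle v^{(i)},u\rangle^2]$ and $x_k:=\log2+\frac{\lambda^2}2\left(k+\sum_{i=1}^k\tau_i\right)$. **(1) Recursion.** If the queries $v^{(1)},\dots,v^{(T)}$ are orthonormal (no condition on $\widehat v$ beyond $\|\widehat v\|=1$), then for all $1\le k\le T$ and all $t>C_2/C_1$, $$\mathbb E_{u\sim\mathcal P}\Pr_u\left[d\langle v^{(k+1)},u\rangle^2\ge t\right]\le \mathbb I(t\le d)\cdot\left(1\wedge\frac{x_k}{C_1t-C_2}\right),$$ and $$\tau_{k+1}\le\frac{C_2}{C_1}+\frac{x_k}{C_1}\left(1+\max\left\{0,\log\frac{C_1d}{x_k}\right\}\right).$$ **(2) Growth.** Fix $C_1,C_2,\lambda>0$, $c\in(0,1)$ and $\varepsilon>0$. There is $d_0$, depending only on these, such that for all $d\ge d_0$, all $\mathcal P$ as above, all $T\le c\,\frac{\log d}{\log\log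 d}$ and all $T$-query algorithms with orthonormal queries, $\tau_k\le\varepsilon d$ for every $1\le k\le T+1$. **(3) Query lower bound.** Fix $C_1,C_2,\lambda>0$, $c\in(0,1)$ and $\eta,\delta>0$. There is $d_0$, depending only on these, such that for all $d\ge d_0$, all $\mathcal P$ as above and all $T$-query algorithms (with arbitrary queries in $\mathbb R^d$), $$\mathbb E_{u\sim\mathcal P}\Pr_u\left[\langle\widehat v,u\rangle^2\ge\eta\right]\ge\delta\quad\Longrightarrow\quad T>c\,\frac{\log d}{\log\log d}.$$ -/

import Mathlib

open MeasureTheory ProbabilityTheory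

instance instMeasurableSpaceMatrixReal (d : ℕ) : MeasurableSpace (Matrix (Fin d) (Fin d) ℝ) :=
  inferInstanceAs (MeasurableSpace (Fin d → Fin d → ℝ))

/-- The Gaussian Orthogonal Ensemble as a law on `d × d` real matrices: the entries on and above
the diagonal are independent, `N(0,2)` on the diagonal and `N(0,1)` off it, and the entries below
the diagonal mirror those above it. -/
noncomputable def goe (d : ℕ) : Measure (Matrix (Fin d) (Fin d) ℝ) :=
  (Measure.pi fun p : Fin d × Fin d => gaussianReal 0 (if p.1 = p.2 then 2 else 1)).map
    fun g => Matrix.of fun i j => g (min i j, max i j)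

/-- The law `ℙ_u` of `M = lam • u uᵀ + (1/√d) • W` with `W ∼ GOE(d)`. -/
noncomputable def spikedLaw (d : ℕ) (lam : ℝ) (u : EuclideanSpace ℝ (Fin d)) :
    Measure (Matrix (Fin d) (Fin d) ℝ) :=
  (goe d).map fun W => lam • Matrix.vecMulVec u.ofLp u.ofLp + (1 / Real.sqrt d) • W

/-- A randomized adaptive query algorithm in dimension `d`, with query complexity `T` and random
seed in `Ξ` (a deterministic algorithm is the case of a one-point seed space). Given the seed and
the `i` pairs (query, response) seen so far, `next i` is the next query; `next T` is the output, a
unit vector. Rounds are counted from `0`, and `next i` plays no role for `i > T`. -/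
structure QueryAlg (d T : ℕ) (Ξ : Type*) [MeasurableSpace Ξ] where
  next : (i : ℕ) → Ξ →
    (Fin i → EuclideanSpace ℝ (Fin d) × EuclideanSpace ℝ (Fin d)) → EuclideanSpace ℝ (Fin d)
  measurable_next : ∀ i, Measurable (Function.uncurry (next i))
  norm_output : ∀ ξ h, ‖next T ξ h‖ = 1

namespace QueryAlg

variable {d T : ℕ} {Ξ : Type*} [MeasurableSpace Ξ]

/-- The first `i` pairs `(v, M v)` when the algorithm runs with seed `ξ` on the matrix `M`. -/
noncomputable def history (A : QueryAlg d T Ξ) (ξ : Ξ) (M : Matrix (Fin d) (Fin d) ℝ) :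
    (i : ℕ) → (Fin i → EuclideanSpace ℝ (Fin d) × EuclideanSpace ℝ (Fin d))
  | 0 => Fin.elim0
  | i + 1 =>
    Fin.snoc (α := fun _ => EuclideanSpace ℝ (Fin d) × EuclideanSpace ℝ (Fin d))
      (A.history ξ M i)
      (A.next i ξ (A.history ξ M i),
        WithLp.toLp 2 (M.mulVec (A.next i ξ (A.history ξ M i)).ofLp))

/-- The vector `v^{(i+1)}`: a query for `i < T`, and the output for `i = T`. -/
noncomputable def vec (A : QueryAlg d T Ξ) (ξ : Ξ) (M : Matrix (Fin d) (Fin d) ℝ) (i : ℕ) :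
    EuclideanSpace ℝ (Fin d) :=
  A.next i ξ (A.history ξ M i)

/-- The output `v̂ = v^{(T+1)}`. -/
noncomputable def output (A : QueryAlg d T Ξ) (ξ : Ξ) (M : Matrix (Fin d) (Fin d) ℝ) :
    EuclideanSpace ℝ (Fin d) :=
  A.vec ξ M T

/-- On every symmetric input the `T` queries `v^{(1)}, …, v^{(T)}` are orthonormal. Nothing is
asked of the output. -/
def OrthonormalQueries (A : QueryAlg d T Ξ) : Prop :=
  ∀ (ξ : Ξ) (M : Matrix (Fin d) (Fin d) ℝ), M.IsSymm →
    Orthonormal ℝ fun i : Fin T => A.vec ξ M i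

/-- `𝔼_{u ∼ P} ℙ_u[d ⟨v^{(i+1)}, u⟩² ≥ t]`, the seed being drawn from `ν` independently. -/
noncomputable def tailProb (A : QueryAlg d T Ξ) (lam : ℝ) (P : Measure (EuclideanSpace ℝ (Fin d)))
    (ν : Measure Ξ) (i : ℕ) (t : ℝ) : ℝ :=
  ∫ u, ((spikedLaw d lam u).prod ν).real {p | t ≤ d * (inner ℝ (A.vec p.2 p.1 i) u) ^ 2} ∂P

/-- `τ_{i+1} = 𝔼_{u ∼ P} 𝔼_{ℙ_u}[d ⟨v^{(i+1)}, u⟩²]`. -/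
noncomputable def tau (A : QueryAlg d T Ξ) (lam : ℝ) (P : Measure (EuclideanSpace ℝ (Fin d)))
    (ν : Measure Ξ) (i : ℕ) : ℝ :=
  ∫ u, ∫ p, d * (inner ℝ (A.vec p.2 p.1 i) u) ^ 2 ∂((spikedLaw d lam u).prod ν) ∂P

/-- `𝔼_{u ∼ P} ℙ_u[⟨v̂, u⟩² ≥ η]`. -/
noncomputable def successProb (A : QueryAlg d T Ξ) (lam : ℝ)
    (P : Measure (EuclideanSpace ℝ (Fin d))) (ν : Measure Ξ) (η : ℝ) : ℝ :=
  ∫ u, ((spikedLaw d lam u).prod ν).real {p | η ≤ (inner ℝ (A.output p.2 p.1) u) ^ 2} ∂P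

end QueryAlg

/-- `P` is an isotropic probability distribution on the unit sphere of `ℝᵈ`
(`𝔼[θ θᵀ] = I / d`) with `sup_{‖v‖ = 1} P[d ⟨v, θ⟩² ≥ t] ≤ exp (C₂ - C₁ t)` for all `t ≥ 0`. -/
structure IsotropicTailPrior (d : ℕ) (C₁ C₂ : ℝ) (P : Measure (EuclideanSpace ℝ (Fin d))) :
    Prop where
  isProbabilityMeasure : IsProbabilityMeasure P
  ae_norm_eq_one : ∀ᵐ u ∂P, ‖u‖ = 1
  isotropic : ∀ i j, ∫ u, u i * u j ∂P = if i = j then 1 / (d : ℝ) else 0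
  tail : ∀ v : EuclideanSpace ℝ (Fin d), ‖v‖ = 1 → ∀ t : ℝ, 0 ≤ t →
    P.real {u | t ≤ d * (inner ℝ v u) ^ 2} ≤ Real.exp (C₂ - C₁ * t)

/-- `log 2 + (lam² / 2) (k + ∑_{i=1}^k τ_i)`. -/
noncomputable def infoBound {d T : ℕ} {Ξ : Type*} [MeasurableSpace Ξ] (A : QueryAlg d T Ξ)
    (lam : ℝ) (P : Measure (EuclideanSpace ℝ (Fin d))) (ν : Measure Ξ) (k : ℕ) : ℝ :=
  Real.log 2 + lam ^ 2 / 2 * (k + ∑ i ∈ Finset.range k, A.tau lam P ν i)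

/-! ### The law of the Gaussian orthogonal ensemble -/

/-! ### Measurability of matrix operations, and characteristic functions of random matrices. -/

section Matrix

variable {d : ℕ}

/-! The proof bounds the information about the spike that the responses carry. Scale the input by
√d, so that it becomes N = a·uuᵀ + W with W a GOE matrix and a = λ√d, and fix u and the seed. Let Q
project onto the orthogonal complement of the first k queries. The responses say nothing about the
block Q N Q. Although Q itself depends on the noise, the block Q W Q may be replaced by that of an
independent copy without changing the law (`lintegral_resample`), because each query is determined
by what was revealed before it. Integrating the block out of the Cameron–Martin density gives the
likelihood ratio of the revealed data (`lintegral_change_of_measure`). With q = ⟨u, Qu⟩, its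
expected logarithm under the spiked law is a²/4 · E(1 - q²) ≤ a²/2 · E(1 - q), which is λ²/2 times
the sum of the expected overlaps d⟨v,u⟩² over the queries.

Under the null law the data are independent of u, so the prior alone bounds the chance of an overlap
at least t by exp(C₂ - C₁t). A variational (Fano-type) inequality, `IsAdaptiveProj.fano`, transfers
this to the spiked law at the price of the information plus log 2, and gives the tail x/(C₁t - C₂)
in `QueryAlg.tail_le`. Integrating the tail over [0, d] gives the recursion.

In the recursion x never drops below log 2, so each step costs at most a factor K log d. After T
steps the overlap is at most (K log d)^(T+1), which is o(d) when T ≤ c log d / log log d with c < 1.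
Markov's inequality then bounds the success probability.

Arbitrary queries reduce to orthogonal ones by Gram–Schmidt: by linearity, the images of the
orthonormalized directions determine all responses. The output is not orthonormalized; it only has
to be a function of the revealed data. -/

theorem measurable_matrix {α : Type*} [MeasurableSpace α] {f : α → Matrix (Fin d) (Fin d) ℝ}
    (h : ∀ i j, Measurable fun x => f x i j) : Measurable f :=
  measurable_pi_lambda _ fun i => measurable_pi_lambda _ fun j => h i j

theorem Measurable.matrix_apply {α : Type*} [MeasurableSpace α]
    {f : α → Matrix (Fin d) (Fin d) ℝ} (h : Measurable f) (i j : Fin d) :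
    Measurable fun x => f x i j :=
  (measurable_pi_apply j).comp ((measurable_pi_apply i).comp h)

theorem measurable_matrix_entry (i j : Fin d) :
    Measurable fun W : Matrix (Fin d) (Fin d) ℝ => W i j :=
  measurable_id.matrix_apply i j

theorem Measurable.matrix_add {α : Type*} [MeasurableSpace α]
    {f g : α → Matrix (Fin d) (Fin d) ℝ} (hf : Measurable f) (hg : Measurable g) :
    Measurable fun x => f x + g x :=
  measurable_matrix fun i j => (hf.matrix_apply i j).add (hg.matrix_apply i j)

theorem Measurable.matrix_sub {α : Type*} [MeasurableSpace α]
    {f g : α → Matrix (Fin d) (Fin d) ℝ} (hf : Measurable f) (hg : Measurable g) :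
    Measurable fun x => f x - g x :=
  measurable_matrix fun i j => (hf.matrix_apply i j).sub (hg.matrix_apply i j)

theorem Measurable.matrix_smul {α : Type*} [MeasurableSpace α] {c : α → ℝ}
    {f : α → Matrix (Fin d) (Fin d) ℝ} (hc : Measurable c) (hf : Measurable f) :
    Measurable fun x => c x • f x :=
  measurable_matrix fun i j => hc.mul (hf.matrix_apply i j)

theorem Measurable.matrix_mul {α : Type*} [MeasurableSpace α]
    {f g : α → Matrix (Fin d) (Fin d) ℝ} (hf : Measurable f) (hg : Measurable g) :
    Measurable fun x => f x * g x :=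
  measurable_matrix fun i j => by
    simp only [Matrix.mul_apply]
    exact Finset.measurable_sum _ fun k _ => (hf.matrix_apply i k).mul (hg.matrix_apply k j)

theorem Measurable.matrix_vecMulVec {α : Type*} [MeasurableSpace α]
    {x y : α → Fin d → ℝ} (hx : Measurable x) (hy : Measurable y) :
    Measurable fun a => Matrix.vecMulVec (x a) (y a) :=
  measurable_matrix fun i j =>
    ((measurable_pi_apply i).comp hx).mul ((measurable_pi_apply j).comp hy)

theorem Measurable.matrix_mulVec {α : Type*} [MeasurableSpace α]
    {f : α → Matrix (Fin d) (Fin d) ℝ} {x : α → Fin d → ℝ} (hf : Measurable f)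
    (hx : Measurable x) : Measurable fun a => (f a).mulVec (x a) := by
  refine measurable_pi_lambda _ fun i => ?_
  simp only [Matrix.mulVec, dotProduct]
  exact Finset.measurable_sum _ fun k _ =>
    (hf.matrix_apply i k).mul ((measurable_pi_apply k).comp hx)

theorem Measurable.dotProduct {α : Type*} [MeasurableSpace α]
    {x y : α → Fin d → ℝ} (hx : Measurable x) (hy : Measurable y) :
    Measurable fun a => x a ⬝ᵥ y a :=
  Finset.measurable_sum _ fun k _ =>
    ((measurable_pi_apply k).comp hx).mul ((measurable_pi_apply k).comp hy)

/-- Used to match sums over the independent entries i ≤ j with sums over all entries of a symmetric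
matrix: it is enough to compare the pair (i, j), (j, i) at once. -/
theorem sum_sum_eq_of_symmetrization_eq {ι : Type*} [Fintype ι] {f g : ι → ι → ℝ}
    (h : ∀ i j, f i j + f j i = g i j + g j i) : ∑ i, ∑ j, f i j = ∑ i, ∑ j, g i j := by
  have key : ∀ k : ι → ι → ℝ, ∑ i, ∑ j, (k i j + k j i) = 2 * ∑ i, ∑ j, k i j := fun k => by
    simp only [Finset.sum_add_distrib]
    rw [Finset.sum_comm (f := fun i j => k j i)]
    ring
  have := key f
  simp only [h, key g] at this
  linarith

/-- Finite measures on real matrices are determined by their characteristic functions. -/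
theorem Matrix.measure_ext_of_integral_cexp {μ ν : Measure (Matrix (Fin d) (Fin d) ℝ)}
    [IsFiniteMeasure μ] [IsFiniteMeasure ν]
    (h : ∀ A : Matrix (Fin d) (Fin d) ℝ,
      ∫ W, Complex.exp ((∑ i, ∑ j, A i j * W i j : ℝ) * Complex.I) ∂μ =
        ∫ W, Complex.exp ((∑ i, ∑ j, A i j * W i j : ℝ) * Complex.I) ∂ν) : μ = ν := by
  let e : Matrix (Fin d) (Fin d) ℝ → EuclideanSpace ℝ (Fin d × Fin d) :=
    fun W => WithLp.toLp 2 fun p => W p.1 p.2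
  let e' : EuclideanSpace ℝ (Fin d × Fin d) → Matrix (Fin d) (Fin d) ℝ :=
    fun x => Matrix.of fun i j => x (i, j)
  have he : Measurable e := (WithLp.measurable_toLp 2 _).comp
    (measurable_pi_lambda _ fun p => measurable_matrix_entry p.1 p.2)
  have he' : Measurable e' := measurable_matrix fun i j => by
    simp only [e', Matrix.of_apply]
    fun_prop
  have hinv : ∀ m : Measure (Matrix (Fin d) (Fin d) ℝ), (m.map e).map e' = m := fun m => by
    rw [Measure.map_map he' he]
    exact Measure.map_id
  rw [← hinv μ, ← hinv ν]
  congr 1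
  refine Measure.ext_of_charFun (funext fun t => ?_)
  simp only [charFun_apply]
  rw [integral_map he.aemeasurable (by fun_prop), integral_map he.aemeasurable (by fun_prop)]
  convert h (Matrix.of fun i j => t (i, j)) using 5 <;>
  · simp [e, PiLp.inner_apply, Fintype.sum_prod_type]

end Matrix

/-! ### Gaussian identities: characteristic function, block resampling and Cameron–Martin. -/

section GOE

variable (d : ℕ)

/-- The variance of the `(i, j)` entry in the Gaussian orthogonal ensemble. -/
noncomputable def goeVar (p : Fin d × Fin d) : NNReal := if p.1 = p.2 then 2 else 1

theorem goeVar_ne_zero (p : Fin d × Fin d) : goeVar d p ≠ 0 := by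
  unfold goeVar; split_ifs <;> simp

theorem measurable_reflect :
    Measurable fun g : Fin d × Fin d → ℝ => (Matrix.of fun i j => g (min i j, max i j) :
      Matrix (Fin d) (Fin d) ℝ) :=
  measurable_matrix fun _ _ => measurable_pi_apply _

theorem goe_eq_map : goe d = (Measure.pi fun p => gaussianReal 0 (goeVar d p)).map
    fun g => Matrix.of fun i j => g (min i j, max i j) := rfl

instance isProbabilityMeasure_goe : IsProbabilityMeasure (goe d) := by
  rw [goe_eq_map]
  exact Measure.isProbabilityMeasure_map (measurable_reflect d).aemeasurable

theorem measurableSet_isSymm : MeasurableSet {W : Matrix (Fin d) (Fin d) ℝ | W.IsSymm} := by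
  have : {W : Matrix (Fin d) (Fin d) ℝ | W.IsSymm} = ⋂ i, ⋂ j, {W | W i j = W j i} := by
    ext W; simp [Matrix.IsSymm.ext_iff, eq_comm]
  rw [this]
  exact MeasurableSet.iInter fun i => MeasurableSet.iInter fun j =>
    measurableSet_eq_fun (measurable_matrix_entry i j) (measurable_matrix_entry j i)

theorem isSymm_ae_goe : ∀ᵐ W ∂goe d, W.IsSymm := by
  rw [goe_eq_map, ae_map_iff (measurable_reflect d).aemeasurable (measurableSet_isSymm d)]
  refine Filter.Eventually.of_forall fun g => Matrix.IsSymm.ext fun i j => ?_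
  simp [min_comm, max_comm]

theorem integrable_goe_apply (i j : Fin d) : Integrable (fun W => W i j) (goe d) := by
  rw [goe_eq_map, integrable_map_measure
    (measurable_matrix_entry i j).aestronglyMeasurable (measurable_reflect d).aemeasurable]
  have h : Integrable (fun x : ℝ => x) (gaussianReal 0 (goeVar d (min i j, max i j))) :=
    (memLp_id_gaussianReal 1).integrable (by simp)
  exact (measurePreserving_eval (fun p => gaussianReal 0 (goeVar d p))
    (min i j, max i j)).integrable_comp_of_integrable h

theorem integral_goe_apply (i j : Fin d) : ∫ W, W i j ∂goe d = 0 := by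
  rw [goe_eq_map, integral_map (measurable_reflect d).aemeasurable
    (measurable_matrix_entry i j).aestronglyMeasurable]
  simp only [Matrix.of_apply]
  rw [← integral_map (φ := fun g : Fin d × Fin d → ℝ => g (min i j, max i j)) (f := fun x => x)
    (measurable_pi_apply _).aemeasurable aestronglyMeasurable_id]
  rw [(measurePreserving_eval (fun p => gaussianReal 0 (goeVar d p)) (min i j, max i j)).map_eq]
  exact integral_id_gaussianReal

/-- The variance 2 on the diagonal makes Var⟨A, W⟩ equal to ‖A + Aᵀ‖²/2 in Frobenius norm. So the
law sees only Frobenius geometry, which is what makes it compatible with projections in arbitrary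
directions. -/
theorem integral_cexp_goe (A : Matrix (Fin d) (Fin d) ℝ) :
    ∫ W, Complex.exp ((∑ i, ∑ j, A i j * W i j : ℝ) * Complex.I) ∂goe d =
      Complex.exp (-((∑ i, ∑ j, (A i j + A j i) ^ 2 : ℝ) / 4)) := by
  let c : Fin d × Fin d → ℝ := fun p =>
    if p.1 < p.2 then A p.1 p.2 + A p.2 p.1 else if p.1 = p.2 then A p.1 p.2 else 0
  have hlin : ∀ g : Fin d × Fin d → ℝ,
      ∑ i, ∑ j, A i j * g (min i j, max i j) = ∑ p, c p * g p := fun g => by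
    rw [Fintype.sum_prod_type]
    refine sum_sum_eq_of_symmetrization_eq fun i j => ?_
    rcases lt_trichotomy i j with h | rfl | h
    · simp [c, h, h.le, h.not_gt, h.ne']; ring
    · simp [c]
    · simp [c, h, h.le, h.not_gt, h.ne']; ring
  have hsq : ∑ p, goeVar d p * c p ^ 2 / 2 = (∑ i, ∑ j, (A i j + A j i) ^ 2) / 4 := by
    rw [Fintype.sum_prod_type]
    simp only [Finset.sum_div]
    refine sum_sum_eq_of_symmetrization_eq fun i j => ?_
    rcases lt_trichotomy i j with h | rfl | h
    · simp [c, goeVar, h, h.not_gt, h.ne', h.ne]; ring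
    · simp [c, goeVar]; ring
    · simp [c, goeVar, h, h.not_gt, h.ne', h.ne]; ring
  rw [goe_eq_map, integral_map (measurable_reflect d).aemeasurable]
  · simp only [Matrix.of_apply, hlin]
    have hprod : ∀ g : Fin d × Fin d → ℝ, Complex.exp (((∑ p, c p * g p : ℝ) : ℂ) * Complex.I) =
        ∏ p, Complex.exp (c p * g p * Complex.I) := fun g => by
      rw [← Complex.exp_sum]; push_cast; rw [Finset.sum_mul]
    simp only [hprod]
    rw [integral_fintype_prod_eq_prod (𝕜 := ℂ)
      (f := fun p (x : ℝ) => Complex.exp (c p * x * Complex.I))]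
    simp only [← charFun_apply_real, charFun_gaussianReal]
    rw [← Complex.exp_sum]
    congr 1
    have hsq' := congrArg Complex.ofReal hsq
    rw [Complex.ofReal_div, Complex.ofReal_ofNat] at hsq'
    rw [← hsq', Complex.ofReal_sum, ← Finset.sum_neg_distrib]
    exact Finset.sum_congr rfl fun p _ => by simp
  · refine Measurable.aestronglyMeasurable ?_
    have : Measurable fun W : Matrix (Fin d) (Fin d) ℝ => ∑ i, ∑ j, A i j * W i j :=
      Finset.measurable_sum _ fun i _ => Finset.measurable_sum _ fun j _ =>
        (measurable_matrix_entry i j).const_mul _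
    fun_prop

/-- Replacing the block `Q W Q` of a `GOE` matrix by that of an independent copy does not change
the law, for a fixed orthogonal projection `Q`. -/
theorem goe_resample (Q : Matrix (Fin d) (Fin d) ℝ) (hs : Q.IsSymm) (hi : Q * Q = Q) :
    ((goe d).prod (goe d)).map (fun p => p.1 - Q * p.1 * Q + Q * p.2 * Q) = goe d := by
  have hm : Measurable fun p : Matrix (Fin d) (Fin d) ℝ × Matrix (Fin d) (Fin d) ℝ =>
      p.1 - Q * p.1 * Q + Q * p.2 * Q :=
    (measurable_fst.matrix_sub ((measurable_const.matrix_mul measurable_fst).matrix_mul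
      measurable_const)).matrix_add
      ((measurable_const.matrix_mul measurable_snd).matrix_mul measurable_const)
  have hP := Measure.isProbabilityMeasure_map (μ := (goe d).prod (goe d)) hm.aemeasurable
  have hme : ∀ A : Matrix (Fin d) (Fin d) ℝ,
      Measurable fun W : Matrix (Fin d) (Fin d) ℝ => ∑ i, ∑ j, A i j * W i j := fun A =>
      Finset.measurable_sum _ fun i _ => Finset.measurable_sum _ fun j _ =>
        (measurable_matrix_entry i j).const_mul _
  refine Matrix.measure_ext_of_integral_cexp fun A => ?_
  have htr : ∀ A W : Matrix (Fin d) (Fin d) ℝ,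
      ∑ i, ∑ j, A i j * W i j = (A * W.transpose).trace := fun A W => by
    simp [Matrix.trace, Matrix.mul_apply]
  have hs' : Q.transpose = Q := hs
  have hmove : ∀ W : Matrix (Fin d) (Fin d) ℝ, ∑ i, ∑ j, A i j * (Q * W * Q) i j =
      ∑ i, ∑ j, (Q * A * Q) i j * W i j := fun W => by
    rw [htr, htr, Matrix.transpose_mul, Matrix.transpose_mul, hs']
    rw [← Matrix.mul_assoc, ← Matrix.mul_assoc, Matrix.trace_mul_comm]
    simp only [Matrix.mul_assoc]
  have hlin : ∀ p : Matrix (Fin d) (Fin d) ℝ × Matrix (Fin d) (Fin d) ℝ,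
      ∑ i, ∑ j, A i j * (p.1 - Q * p.1 * Q + Q * p.2 * Q) i j =
        ∑ i, ∑ j, (A - Q * A * Q) i j * p.1 i j + ∑ i, ∑ j, (Q * A * Q) i j * p.2 i j := by
    intro p
    rw [← hmove p.2]
    simp only [Matrix.add_apply, Matrix.sub_apply, mul_add, mul_sub, sub_mul,
      Finset.sum_add_distrib, Finset.sum_sub_distrib]
    rw [hmove p.1]
  have hmc : Measurable fun W : Matrix (Fin d) (Fin d) ℝ =>
      Complex.exp ((∑ i, ∑ j, A i j * W i j : ℝ) * Complex.I) :=
    Complex.measurable_exp.comp ((Complex.measurable_ofReal.comp (hme A)).mul_const _)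
  rw [integral_map hm.aemeasurable hmc.aestronglyMeasurable]
  simp only [hlin]
  have hsplit : ∀ p : Matrix (Fin d) (Fin d) ℝ × Matrix (Fin d) (Fin d) ℝ,
      Complex.exp (((∑ i, ∑ j, (A - Q * A * Q) i j * p.1 i j +
        ∑ i, ∑ j, (Q * A * Q) i j * p.2 i j : ℝ) : ℂ) * Complex.I) =
      Complex.exp ((∑ i, ∑ j, (A - Q * A * Q) i j * p.1 i j : ℝ) * Complex.I) *
      Complex.exp ((∑ i, ∑ j, (Q * A * Q) i j * p.2 i j : ℝ) * Complex.I) := fun p => by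
    rw [← Complex.exp_add, Complex.ofReal_add, add_mul]
  simp only [hsplit]
  rw [integral_prod_mul (μ := goe d) (ν := goe d)
    (fun W : Matrix (Fin d) (Fin d) ℝ =>
      Complex.exp ((∑ i, ∑ j, (A - Q * A * Q) i j * W i j : ℝ) * Complex.I))
    (fun W : Matrix (Fin d) (Fin d) ℝ =>
      Complex.exp ((∑ i, ∑ j, (Q * A * Q) i j * W i j : ℝ) * Complex.I)),
    integral_cexp_goe, integral_cexp_goe, integral_cexp_goe, ← Complex.exp_add]
  congr 1
  rw [← neg_add, ← add_div, ← Complex.ofReal_add]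
  congr 3
  have hB : ∀ B : Matrix (Fin d) (Fin d) ℝ, ∑ i, ∑ j, (B i j + B j i) ^ 2 =
      ((B + B.transpose) * (B + B.transpose)).trace := fun B => by
    simp only [Matrix.trace, Matrix.diag, Matrix.mul_apply, Matrix.add_apply,
      Matrix.transpose_apply]
    exact Finset.sum_congr rfl fun i _ => Finset.sum_congr rfl fun j _ => by ring
  simp only [hB, Matrix.transpose_sub, Matrix.transpose_mul, hs']
  set B := A + A.transpose with hBdef
  have e1 : A - Q * A * Q + (A.transpose - Q * (A.transpose * Q)) = B - Q * B * Q := by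
    rw [hBdef]; noncomm_ring
  have e2 : Q * A * Q + Q * (A.transpose * Q) = Q * B * Q := by rw [hBdef]; noncomm_ring
  rw [e1, e2]
  -- `c1` and `c2` say that Q B Q and B - Q B Q are Frobenius-orthogonal, so their squared norms add
  -- up to that of B, by Pythagoras.
  have c1 : (B * (Q * B * Q)).trace = (Q * B * Q * (Q * B * Q)).trace := by
    have : Q * B * Q * (Q * B * Q) = Q * (B * Q * B * Q) := by
      calc _ = Q * B * (Q * Q) * B * Q := by noncomm_ring
        _ = _ := by rw [hi]; noncomm_ring
    rw [this, Matrix.trace_mul_comm Q, Matrix.mul_assoc (B * Q * B), hi]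
    simp only [Matrix.mul_assoc]
  have c2 : (Q * B * Q * B).trace = (Q * B * Q * (Q * B * Q)).trace := by
    rw [Matrix.trace_mul_comm, c1]
  have : (B - Q * B * Q) * (B - Q * B * Q) =
    B * B - B * (Q * B * Q) - Q * B * Q * B + Q * B * Q * (Q * B * Q) := by noncomm_ring
  rw [this, Matrix.trace_add, Matrix.trace_sub, Matrix.trace_sub, c1, c2]
  ring

/-- The Cameron–Martin formula for a product of centred Gaussian laws. -/
theorem map_add_pi_gaussianReal {ι : Type*} [Fintype ι] (v : ι → NNReal) (hv : ∀ i, v i ≠ 0)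
    (b : ι → ℝ) :
    (Measure.pi fun i => gaussianReal 0 (v i)).map (fun g i => g i + b i) =
      (Measure.pi fun i => gaussianReal 0 (v i)).withDensity
        fun g => ENNReal.ofReal (Real.exp (∑ i, (b i * g i / v i - b i ^ 2 / (2 * v i)))) := by
  have h1 : ∀ i, (gaussianReal 0 (v i)).map (· + b i) = (gaussianReal 0 (v i)).withDensity
      fun x => ENNReal.ofReal (Real.exp (b i * x / v i - b i ^ 2 / (2 * v i))) := fun i => by
    rw [gaussianReal_map_add_const, gaussianReal_of_var_ne_zero _ (hv i),
      gaussianReal_of_var_ne_zero _ (hv i), ← withDensity_mul _ (measurable_gaussianPDF _ _)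
        (by fun_prop)]
    congr 1
    ext x
    simp only [Pi.mul_apply, gaussianPDF]
    rw [← ENNReal.ofReal_mul (gaussianPDFReal_nonneg _ _ _)]
    congr 1
    simp only [gaussianPDFReal]
    rw [mul_assoc (_⁻¹), ← Real.exp_add]
    congr 2
    have : (v i : ℝ) ≠ 0 := by exact_mod_cast hv i
    field_simp
    ring
  rw [Measure.pi_map_pi (f := fun i x => x + b i) fun i => by fun_prop]
  refine Measure.pi_eq fun s hs => ?_
  rw [withDensity_apply _ (MeasurableSet.univ_pi hs), ← lintegral_indicator
    (MeasurableSet.univ_pi hs)]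
  have hfac : ∀ g : ι → ℝ, (Set.univ.pi s).indicator (fun g => ENNReal.ofReal
      (Real.exp (∑ i, (b i * g i / v i - b i ^ 2 / (2 * v i))))) g =
      ∏ i, (s i).indicator (fun x => ENNReal.ofReal
        (Real.exp (b i * x / v i - b i ^ 2 / (2 * v i)))) (g i) := fun g => by
    by_cases hg : ∀ i, g i ∈ s i
    · rw [Set.indicator_of_mem (by simpa using hg), Real.exp_sum,
        ENNReal.ofReal_prod_of_nonneg fun i _ => (Real.exp_pos _).le]
      exact Finset.prod_congr rfl fun i _ => by rw [Set.indicator_of_mem (hg i)]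
    · rw [Set.indicator_of_notMem (by simpa using hg)]
      push Not at hg
      obtain ⟨i, hi⟩ := hg
      exact (Finset.prod_eq_zero (Finset.mem_univ i) (Set.indicator_of_notMem hi _)).symm
  simp only [hfac]
  have hmeas : ∀ i, Measurable ((s i).indicator fun x => ENNReal.ofReal
      (Real.exp (b i * x / v i - b i ^ 2 / (2 * v i)))) := fun i =>
    Measurable.indicator (by fun_prop) (hs i)
  rw [lintegral_prod_eq_prod_lintegral_of_indepFun (μ := Measure.pi fun i => gaussianReal 0 (v i))
    Finset.univ (fun i g => (s i).indicator (fun x => ENNReal.ofReal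
        (Real.exp (b i * x / v i - b i ^ 2 / (2 * v i)))) (g i))
    (iIndepFun_pi fun i => (hmeas i).aemeasurable)
    fun i => (hmeas i).comp (measurable_pi_apply i)]
  refine Finset.prod_congr rfl fun i _ => ?_
  rw [h1, withDensity_apply _ (hs i), ← lintegral_indicator (hs i),
    ← (measurePreserving_eval (fun i => gaussianReal 0 (v i)) i).map_eq,
    lintegral_map (hmeas i) (measurable_pi_apply i)]

/-- The Cameron–Martin formula for a rank-one shift of a `GOE` matrix. -/
theorem lintegral_goe_add_vecMulVec (a : ℝ) (u : Fin d → ℝ)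
    (F : Matrix (Fin d) (Fin d) ℝ → ENNReal) (hF : Measurable F) :
    ∫⁻ W, F (W + a • Matrix.vecMulVec u u) ∂goe d =
      ∫⁻ W, F W * ENNReal.ofReal
        (Real.exp (a / 2 * (u ⬝ᵥ W.mulVec u) - a ^ 2 / 4 * (u ⬝ᵥ u) ^ 2)) ∂goe d := by
  -- Only the coordinates on and above the diagonal are shifted, since the reflection reads no
  -- others. The density then costs each off-diagonal pair once, and each diagonal entry with half
  -- weight because of its variance 2.
  let b : Fin d × Fin d → ℝ := fun p => if p.1 ≤ p.2 then a * (u p.1 * u p.2) else 0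
  have hr := measurable_reflect d
  have hq : Measurable fun W : Matrix (Fin d) (Fin d) ℝ => u ⬝ᵥ W.mulVec u :=
    measurable_const.dotProduct (measurable_id.matrix_mulVec measurable_const)
  have hshift : ∀ g : Fin d × Fin d → ℝ,
      (Matrix.of fun i j => g (min i j, max i j)) + a • Matrix.vecMulVec u u =
      Matrix.of fun i j => (g (min i j, max i j) + b (min i j, max i j)) := fun g => by
    ext i j
    rcases le_total i j with h | h
    · simp [b, h, Matrix.vecMulVec_apply]
    · simp [b, h, Matrix.vecMulVec_apply, mul_comm (u i)]
  have hexp : ∀ g : Fin d × Fin d → ℝ,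
      a / 2 * (u ⬝ᵥ (Matrix.of fun i j => g (min i j, max i j) :
        Matrix (Fin d) (Fin d) ℝ).mulVec u) - a ^ 2 / 4 * (u ⬝ᵥ u) ^ 2 =
      ∑ p, (b p * g p / goeVar d p - b p ^ 2 / (2 * goeVar d p)) := fun g => by
    rw [Fintype.sum_prod_type, sq (u ⬝ᵥ u)]
    simp only [dotProduct, Matrix.mulVec, Matrix.of_apply, Finset.mul_sum, Finset.sum_mul,
      ← Finset.sum_sub_distrib]
    refine sum_sum_eq_of_symmetrization_eq fun i j => ?_
    rcases lt_trichotomy i j with h | rfl | h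
    · simp [b, goeVar, h.le, h.not_ge, h.ne', h.ne]; ring
    · simp [b, goeVar]; ring
    · simp [b, goeVar, h.le, h.not_ge, h.ne', h.ne]; ring
  have hFa : Measurable fun W => F (W + a • Matrix.vecMulVec u u) :=
    hF.comp (measurable_id.matrix_add measurable_const)
  rw [goe_eq_map, lintegral_map hFa hr, lintegral_map (by fun_prop) hr]
  simp only [hshift, hexp]
  have := map_add_pi_gaussianReal (goeVar d) (goeVar_ne_zero d) b
  have hFr : Measurable fun g : Fin d × Fin d → ℝ =>
      F (Matrix.of fun i j => g (min i j, max i j)) := hF.comp hr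
  rw [← lintegral_map (f := fun g => F (Matrix.of fun i j => g (min i j, max i j)))
    (μ := Measure.pi fun p => gaussianReal 0 (goeVar d p))
    (g := fun (g : Fin d × Fin d → ℝ) p => g p + b p) hFr (by fun_prop), this,
    lintegral_withDensity_eq_lintegral_mul _ (by fun_prop) hFr]
  simp only [Pi.mul_apply, mul_comm]

/-- The exponential moments of the quadratic form of a `GOE` matrix. -/
theorem lintegral_exp_quadratic_goe (a : ℝ) (u : Fin d → ℝ) :
    ∫⁻ W, ENNReal.ofReal (Real.exp (a / 2 * (u ⬝ᵥ W.mulVec u))) ∂goe d =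
      ENNReal.ofReal (Real.exp (a ^ 2 / 4 * (u ⬝ᵥ u) ^ 2)) := by
  -- With a constant integrand, Cameron–Martin says that its density has total mass one, which is
  -- the exponential moment up to normalization.
  have h := lintegral_goe_add_vecMulVec d a u
    (fun _ => ENNReal.ofReal (Real.exp (a ^ 2 / 4 * (u ⬝ᵥ u) ^ 2))) measurable_const
  rw [lintegral_const, measure_univ, mul_one] at h
  rw [h]
  congr 1
  ext W
  rw [← ENNReal.ofReal_mul (Real.exp_pos _).le, ← Real.exp_add]
  congr 2
  ring

theorem integrable_quadratic_goe (u : Fin d → ℝ) :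
    Integrable (fun W => u ⬝ᵥ W.mulVec u) (goe d) := by
  simp only [dotProduct, Matrix.mulVec]
  exact integrable_finsetSum _ fun i _ => (integrable_finsetSum _ fun j _ =>
    (integrable_goe_apply d i j).mul_const _).const_mul _

theorem integral_quadratic_goe (u : Fin d → ℝ) : ∫ W, u ⬝ᵥ W.mulVec u ∂goe d = 0 := by
  simp only [dotProduct, Matrix.mulVec]
  rw [integral_finsetSum _ fun i _ => (integrable_finsetSum _ fun j _ =>
    (integrable_goe_apply d i j).mul_const _).const_mul _]
  refine Finset.sum_eq_zero fun i _ => ?_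
  rw [integral_const_mul, integral_finsetSum _ fun j _ =>
    (integrable_goe_apply d i j).mul_const _]
  simp [integral_mul_const, integral_goe_apply]

end GOE

/-! ### Adaptive projections of a Gaussian matrix -/

/-- A decreasing sequence of orthogonal projections `Q k M`, starting at `1`, such that the `k`-th
and the `(k+1)`-st do not depend on the block `Q k M * M * Q k M` of the matrix `M`. -/
structure IsAdaptiveProj {d : ℕ}
    (Q : ℕ → Matrix (Fin d) (Fin d) ℝ → Matrix (Fin d) (Fin d) ℝ) : Prop where
  measurable : ∀ k, Measurable (Q k)
  zero : ∀ M, Q 0 M = 1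
  isSymm : ∀ k M, (Q k M).IsSymm
  mul_self : ∀ k M, Q k M * Q k M = Q k M
  mul_succ : ∀ k M, Q k M * Q (k + 1) M = Q (k + 1) M
  congr_self : ∀ k M Y, Q k (M + Q k M * Y * Q k M) = Q k M
  congr_succ : ∀ k M Y, Q (k + 1) (M + Q k M * Y * Q k M) = Q (k + 1) M

namespace IsAdaptiveProj

variable {d : ℕ} {Q : ℕ → Matrix (Fin d) (Fin d) ℝ → Matrix (Fin d) (Fin d) ℝ}

theorem succ_mul (hQ : IsAdaptiveProj Q) (k : ℕ) (M : Matrix (Fin d) (Fin d) ℝ) :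
    Q (k + 1) M * Q k M = Q (k + 1) M := by
  have h := congrArg Matrix.transpose (hQ.mul_succ k M)
  rwa [Matrix.transpose_mul, (hQ.isSymm k M : _ = _), (hQ.isSymm (k + 1) M : _ = _)] at h

theorem _root_.measurable_resample {α : Type*} [MeasurableSpace α]
    {R W W' : α → Matrix (Fin d) (Fin d) ℝ} (hR : Measurable R) (hW : Measurable W)
    (hW' : Measurable W') : Measurable fun x => W x - R x * W x * R x + R x * W' x * R x :=
  (hW.matrix_sub ((hR.matrix_mul hW).matrix_mul hR)).matrix_add ((hR.matrix_mul hW').matrix_mul hR)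

theorem _root_.lintegral_goe_resample (R : Matrix (Fin d) (Fin d) ℝ) (hs : R.IsSymm)
    (hi : R * R = R) {F : Matrix (Fin d) (Fin d) ℝ → ENNReal} (hF : Measurable F) :
    ∫⁻ W, ∫⁻ W', F (W - R * W * R + R * W' * R) ∂goe d ∂goe d = ∫⁻ W, F W ∂goe d := by
  have hm : Measurable fun p : Matrix (Fin d) (Fin d) ℝ × Matrix (Fin d) (Fin d) ℝ =>
    p.1 - R * p.1 * R + R * p.2 * R := measurable_resample measurable_const measurable_fst
      measurable_snd
  conv_rhs => rw [← goe_resample d R hs hi, lintegral_map hF hm]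
  have hFm : Measurable fun p : Matrix (Fin d) (Fin d) ℝ × Matrix (Fin d) (Fin d) ℝ =>
    F (p.1 - R * p.1 * R + R * p.2 * R) := hF.comp hm
  rw [lintegral_prod _ hFm.aemeasurable]

/-- Resampling the block of a `GOE` matrix that adaptive projections have not revealed does not
change its law. -/
theorem lintegral_resample (hQ : IsAdaptiveProj Q) (S : Matrix (Fin d) (Fin d) ℝ) (k : ℕ)
    {F : Matrix (Fin d) (Fin d) ℝ → ENNReal} (hF : Measurable F) :
    ∫⁻ W, ∫⁻ W', F (W - Q k (S + W) * W * Q k (S + W) + Q k (S + W) * W' * Q k (S + W))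
      ∂goe d ∂goe d = ∫⁻ W, F W ∂goe d := by
  induction k generalizing F with
  | zero => simp [hQ.zero]
  | succ k ih =>
    have hQm : ∀ k, Measurable fun W => Q k (S + W) := fun k =>
      (hQ.measurable k).comp (measurable_const.matrix_add measurable_id)
    have hG : Measurable fun W => ∫⁻ W', F (W - Q (k + 1) (S + W) * W * Q (k + 1) (S + W) +
        Q (k + 1) (S + W) * W' * Q (k + 1) (S + W)) ∂goe d :=
      Measurable.lintegral_prod_right' (hF.comp (measurable_resample
        ((hQm (k + 1)).comp measurable_fst) measurable_fst measurable_snd))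
    -- Both sides now start with a resampling of the larger block R W R. This leaves the smaller
    -- projection R' unchanged by `congr_succ`, so that for fixed W it is a constant projection for
    -- the fresh copy W', and the non-adaptive resampling applies to W'.
    rw [← ih hG, ← ih hF]
    refine lintegral_congr fun W => ?_
    set R := Q k (S + W) with hR
    set R' := Q (k + 1) (S + W) with hR'
    have hF' : Measurable fun W' => F (W - R * W * R + R * W' * R) :=
      hF.comp (measurable_resample measurable_const measurable_const measurable_id)
    rw [← lintegral_goe_resample R' (hQ.isSymm _ _) (hQ.mul_self _ _) hF']
    refine lintegral_congr fun W' => lintegral_congr fun W'' => ?_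
    have e : S + (W - R * W * R + R * W' * R) = (S + W) + R * (W' - W) * R := by noncomm_ring
    rw [e, hR, hQ.congr_succ, ← hR, ← hR']
    have h1 : R * R' = R' := hQ.mul_succ k (S + W)
    have h2 : R' * R = R' := hQ.succ_mul k (S + W)
    congr 1
    have e1 : R * (W' - R' * W' * R' + R' * W'' * R') * R =
        R * W' * R - (R * R') * W' * (R' * R) + (R * R') * W'' * (R' * R) := by noncomm_ring
    have e2 : R' * (W - R * W * R + R * W' * R) * R' =
        R' * W * R' - (R' * R) * W * (R * R') + (R' * R) * W' * (R * R') := by noncomm_ring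
    rw [e1, e2, h1, h2]
    noncomm_ring

theorem map_resample (hQ : IsAdaptiveProj Q) (S : Matrix (Fin d) (Fin d) ℝ) (k : ℕ) :
    ((goe d).prod (goe d)).map (fun p => p.1 - Q k (S + p.1) * p.1 * Q k (S + p.1) +
      Q k (S + p.1) * p.2 * Q k (S + p.1)) = goe d := by
  have hm : Measurable fun p : Matrix (Fin d) (Fin d) ℝ × Matrix (Fin d) (Fin d) ℝ =>
      p.1 - Q k (S + p.1) * p.1 * Q k (S + p.1) + Q k (S + p.1) * p.2 * Q k (S + p.1) :=
    measurable_resample ((hQ.measurable k).comp (measurable_const.matrix_add measurable_fst))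
      measurable_fst measurable_snd
  refine Measure.ext_of_lintegral _ fun F hF => ?_
  have hFm : Measurable fun p : Matrix (Fin d) (Fin d) ℝ × Matrix (Fin d) (Fin d) ℝ =>
      F (p.1 - Q k (S + p.1) * p.1 * Q k (S + p.1) + Q k (S + p.1) * p.2 * Q k (S + p.1)) :=
    hF.comp hm
  rw [lintegral_map hF hm, lintegral_prod _ hFm.aemeasurable,
    hQ.lintegral_resample S k hF]

theorem dotProduct_mulVec_self (hQ : IsAdaptiveProj Q) (k : ℕ) (M W : Matrix (Fin d) (Fin d) ℝ)
    (u : Fin d → ℝ) : u ⬝ᵥ (Q k M * W * Q k M).mulVec u =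
      (Q k M).mulVec u ⬝ᵥ W.mulVec ((Q k M).mulVec u) := by
  rw [← Matrix.mulVec_mulVec, ← Matrix.mulVec_mulVec, Matrix.dotProduct_mulVec,
    ← Matrix.mulVec_transpose, (hQ.isSymm k M : _ = _)]

theorem mulVec_dotProduct_mulVec (hQ : IsAdaptiveProj Q) (k : ℕ) (M : Matrix (Fin d) (Fin d) ℝ)
    (u : Fin d → ℝ) : (Q k M).mulVec u ⬝ᵥ (Q k M).mulVec u = u ⬝ᵥ (Q k M).mulVec u := by
  have := hQ.dotProduct_mulVec_self k M 1 u
  rwa [Matrix.one_mulVec, Matrix.mul_one, hQ.mul_self, eq_comm] at this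

theorem mulVec_dotProduct_mulVec_le (hQ : IsAdaptiveProj Q) (k : ℕ)
    (M : Matrix (Fin d) (Fin d) ℝ) (u : Fin d → ℝ) :
    (Q k M).mulVec u ⬝ᵥ (Q k M).mulVec u ≤ u ⬝ᵥ u := by
  have h : 0 ≤ (u - (Q k M).mulVec u) ⬝ᵥ (u - (Q k M).mulVec u) :=
    Finset.sum_nonneg fun i _ => mul_self_nonneg _
  rw [sub_dotProduct, dotProduct_sub, dotProduct_sub, dotProduct_comm ((Q k M).mulVec u) u,
    ← hQ.mulVec_dotProduct_mulVec k M u] at h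
  linarith

/-- The change of measure from the null law to a rank-one shift of it, on the events that do not
depend on the unrevealed block. -/
theorem lintegral_change_of_measure (hQ : IsAdaptiveProj Q) (k : ℕ) (a : ℝ) (u : Fin d → ℝ)
    (hu : u ⬝ᵥ u = 1) {h : Matrix (Fin d) (Fin d) ℝ → ENNReal} (hm : Measurable h)
    (hh : ∀ M Y, h (M + Q k M * Y * Q k M) = h M) :
    ∫⁻ W, h W ∂goe d = ∫⁻ W, h (a • Matrix.vecMulVec u u + W) * ENNReal.ofReal (Real.exp
      (-(a / 2 * (u ⬝ᵥ W.mulVec u -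
          u ⬝ᵥ (Q k (a • Matrix.vecMulVec u u + W) * W *
            Q k (a • Matrix.vecMulVec u u + W)).mulVec u) +
        a ^ 2 / 4 * (1 - (u ⬝ᵥ (Q k (a • Matrix.vecMulVec u u + W)).mulVec u) ^ 2))))
      ∂goe d := by
  set S := a • Matrix.vecMulVec u u with hS
  have hq : Measurable fun W : Matrix (Fin d) (Fin d) ℝ => u ⬝ᵥ W.mulVec u :=
    measurable_const.dotProduct (measurable_id.matrix_mulVec measurable_const)
  have hSm : Measurable fun W : Matrix (Fin d) (Fin d) ℝ => h (S + W) :=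
    hm.comp (measurable_const.matrix_add measurable_id)
  have h1 : ∫⁻ W, h W ∂goe d = ∫⁻ W, h (S + W) * ENNReal.ofReal (Real.exp
      (-(a / 2 * (u ⬝ᵥ W.mulVec u) + a ^ 2 / 4))) ∂goe d := by
    -- The weight is the inverse of the Cameron–Martin density. After the shift, ⟨u, Su⟩ = a turns
    -- its constant a²/4 into -a²/2 + a²/4 = -a²/4.
    have hF : Measurable fun W : Matrix (Fin d) (Fin d) ℝ => h W * ENNReal.ofReal (Real.exp
        (-(a / 2 * (u ⬝ᵥ W.mulVec u)) + a ^ 2 / 4)) := by fun_prop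
    have := lintegral_goe_add_vecMulVec d a u _ hF
    rw [hu] at this
    convert this.symm using 1
    · refine lintegral_congr fun W => ?_
      rw [mul_assoc, ← ENNReal.ofReal_mul (Real.exp_pos _).le, ← Real.exp_add]
      ring_nf
      simp
    · refine lintegral_congr fun W => ?_
      rw [add_comm W, ← hS]
      congr 3
      have : u ⬝ᵥ S.mulVec u = a := by
        rw [hS, Matrix.smul_mulVec, Matrix.vecMulVec_mulVec]
        simp [hu]
      rw [Matrix.add_mulVec, dotProduct_add, this]
      ring
  have hF : Measurable fun W => h (S + W) * ENNReal.ofReal (Real.exp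
      (-(a / 2 * (u ⬝ᵥ W.mulVec u) + a ^ 2 / 4))) := hSm.mul (by clear_value S; fun_prop)
  rw [h1, ← hQ.lintegral_resample S k hF]
  refine lintegral_congr fun W => ?_
  set R := Q k (S + W) with hR
  set z := R.mulVec u with hz
  have e : ∀ W', S + (W - R * W * R + R * W' * R) = (S + W) + R * (W' - W) * R := fun W' => by
    noncomm_ring
  have e2 : ∀ W', h (S + (W - R * W * R + R * W' * R)) = h (S + W) := fun W' => by
    rw [e, hR, hh]
  simp only [e2]
  rw [lintegral_const_mul _ (by
    have : Measurable fun W' => W - R * W * R + R * W' * R :=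
      measurable_resample measurable_const measurable_const measurable_id
    have := hq.comp this
    simp only [Function.comp_def] at this
    fun_prop)]
  congr 1
  have hz' : z ⬝ᵥ z = u ⬝ᵥ R.mulVec u := hQ.mulVec_dotProduct_mulVec k (S + W) u
  have hzq : ∀ W', u ⬝ᵥ (R * W' * R).mulVec u = z ⬝ᵥ W'.mulVec z := fun W' =>
    hQ.dotProduct_mulVec_self k (S + W) W' u
  have hz2 := lintegral_exp_quadratic_goe d (-a) z
  have hqz : Measurable fun W : Matrix (Fin d) (Fin d) ℝ => z ⬝ᵥ W.mulVec z :=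
    measurable_const.dotProduct (measurable_id.matrix_mulVec measurable_const)
  have e3 : ∀ W', ENNReal.ofReal (Real.exp (-(a / 2 *
      (u ⬝ᵥ (W - R * W * R + R * W' * R).mulVec u) + a ^ 2 / 4))) =
      ENNReal.ofReal (Real.exp (-(a / 2 * (u ⬝ᵥ W.mulVec u - u ⬝ᵥ (R * W * R).mulVec u) +
        a ^ 2 / 4))) * ENNReal.ofReal (Real.exp (-a / 2 * (z ⬝ᵥ W'.mulVec z))) := fun W' => by
    rw [← ENNReal.ofReal_mul (Real.exp_pos _).le, ← Real.exp_add, Matrix.add_mulVec,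
      Matrix.sub_mulVec, dotProduct_add, dotProduct_sub, hzq W']
    congr 2
    ring
  simp only [e3]
  -- The fresh block enters only through ⟨z, W'z⟩ with z = Ru fixed. Its exponential moment exp(a²/4
  -- · (z·z)²) accounts for the term q² in the exponent.
  rw [lintegral_const_mul _ (by fun_prop), hz2, ← ENNReal.ofReal_mul (Real.exp_pos _).le,
    ← Real.exp_add, hz']
  congr 2
  ring

theorem integrable_revealed (hQ : IsAdaptiveProj Q) (S : Matrix (Fin d) (Fin d) ℝ) (k : ℕ)
    (u : Fin d → ℝ) (hu : u ⬝ᵥ u = 1) :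
    Integrable (fun W => u ⬝ᵥ (Q k (S + W) * W * Q k (S + W)).mulVec u) (goe d) := by
  have hQm : Measurable fun W => Q k (S + W) :=
    (hQ.measurable k).comp (measurable_const.matrix_add measurable_id)
  have hdom : Integrable (fun W : Matrix (Fin d) (Fin d) ℝ => ∑ i, ∑ j, |W i j|) (goe d) :=
    integrable_finsetSum _ fun i _ => integrable_finsetSum _ fun j _ =>
      (integrable_goe_apply d i j).abs
  refine hdom.mono' (measurable_const.dotProduct (((hQm.matrix_mul
    measurable_id).matrix_mul hQm).matrix_mulVec measurable_const)).aestronglyMeasurable ?_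
  refine Filter.Eventually.of_forall fun W => ?_
  rw [hQ.dotProduct_mulVec_self]
  set z := (Q k (S + W)).mulVec u with hz
  have hz1 : z ⬝ᵥ z ≤ 1 := hu ▸ hQ.mulVec_dotProduct_mulVec_le k (S + W) u
  have hzi : ∀ i, |z i| ≤ 1 := fun i => by
    rw [abs_le_one_iff_mul_self_le_one]
    exact (Finset.single_le_sum (f := fun i => z i * z i) (fun j _ => mul_self_nonneg _)
      (Finset.mem_univ i)).trans hz1
  simp only [dotProduct, Matrix.mulVec, Finset.mul_sum, Real.norm_eq_abs]
  refine (Finset.abs_sum_le_sum_abs _ _).trans (Finset.sum_le_sum fun i _ =>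
    (Finset.abs_sum_le_sum_abs _ _).trans (Finset.sum_le_sum fun j _ => ?_))
  rw [abs_mul, abs_mul]
  calc |z i| * (|W i j| * |z j|) ≤ 1 * (|W i j| * 1) := by
        gcongr
        · exact hzi i
        · exact hzi j
    _ = |W i j| := by ring

/-- Q and W are dependent, yet after resampling the block is that of an independent copy while Q is
unchanged by `congr_self`. Conditionally on W this is the quadratic form of a centred matrix at a
fixed vector. -/
theorem integral_revealed (hQ : IsAdaptiveProj Q) (S : Matrix (Fin d) (Fin d) ℝ) (k : ℕ)
    (u : Fin d → ℝ) (hu : u ⬝ᵥ u = 1) :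
    ∫ W, u ⬝ᵥ (Q k (S + W) * W * Q k (S + W)).mulVec u ∂goe d = 0 := by
  have hQm : Measurable fun W => Q k (S + W) :=
    (hQ.measurable k).comp (measurable_const.matrix_add measurable_id)
  have hint := hQ.integrable_revealed S k u hu
  have hm : Measurable fun p : Matrix (Fin d) (Fin d) ℝ × Matrix (Fin d) (Fin d) ℝ =>
      p.1 - Q k (S + p.1) * p.1 * Q k (S + p.1) + Q k (S + p.1) * p.2 * Q k (S + p.1) :=
    measurable_resample (hQm.comp measurable_fst) measurable_fst measurable_snd
  have hmap := hQ.map_resample S k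
  have hint' := hint
  rw [← hmap] at hint'
  have hsm := hint'.aestronglyMeasurable
  rw [integrable_map_measure hsm hm.aemeasurable] at hint'
  rw [← hmap, integral_map hm.aemeasurable hsm]
  have heq : ∀ p : Matrix (Fin d) (Fin d) ℝ × Matrix (Fin d) (Fin d) ℝ,
      (fun W => u ⬝ᵥ (Q k (S + W) * W * Q k (S + W)).mulVec u)
        (p.1 - Q k (S + p.1) * p.1 * Q k (S + p.1) + Q k (S + p.1) * p.2 * Q k (S + p.1)) =
      (Q k (S + p.1)).mulVec u ⬝ᵥ p.2.mulVec ((Q k (S + p.1)).mulVec u) := fun p => by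
    set R := Q k (S + p.1) with hR
    have e : S + (p.1 - R * p.1 * R + R * p.2 * R) = (S + p.1) + R * (p.2 - p.1) * R := by
      noncomm_ring
    have hRR : R * R = R := hQ.mul_self _ _
    have e2 : R * (p.1 - R * p.1 * R + R * p.2 * R) * R =
        R * p.1 * R - (R * R) * p.1 * (R * R) + (R * R) * p.2 * (R * R) := by noncomm_ring
    rw [hRR, sub_self, zero_add] at e2
    simp only [e]
    rw [hR, hQ.congr_self, ← hR, e2, hR, hQ.dotProduct_mulVec_self]
  have hint2 := hint'.congr (Filter.Eventually.of_forall heq)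
  rw [integral_congr_ae (Filter.Eventually.of_forall heq), integral_prod _ hint2]
  simp only [integral_quadratic_goe, integral_zero]

/-- A Fano-type inequality: an event that depends on the revealed part of the matrix only can be
likely under the shifted law only if it is not too unlikely under the null law, or if the revealed
part overlaps with the shift. -/
theorem fano (hQ : IsAdaptiveProj Q) (k : ℕ) (a : ℝ) (u : Fin d → ℝ)
    (hu : u ⬝ᵥ u = 1) {E : Set (Matrix (Fin d) (Fin d) ℝ)} (hE : MeasurableSet E)
    (hEQ : ∀ M Y, M + Q k M * Y * Q k M ∈ E ↔ M ∈ E) (α : ℝ) :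
    2 * (1 + α * (goe d).real {W | a • Matrix.vecMulVec u u + W ∈ E} -
        a ^ 2 / 2 * ∫ W, (1 - u ⬝ᵥ (Q k (a • Matrix.vecMulVec u u + W)).mulVec u) ∂goe d -
        Real.log 2) ≤ 1 + (Real.exp α - 1) * (goe d).real E := by
  classical
  set S := a • Matrix.vecMulVec u u with hS
  let f : Matrix (Fin d) (Fin d) ℝ → ℝ := E.indicator fun _ => α
  have hf : Measurable f := measurable_const.indicator hE
  have hSm : Measurable fun W : Matrix (Fin d) (Fin d) ℝ => S + W :=
    measurable_const.matrix_add measurable_id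
  have hQm : Measurable fun W => Q k (S + W) := (hQ.measurable k).comp hSm
  let q : Matrix (Fin d) (Fin d) ℝ → ℝ := fun W => u ⬝ᵥ (Q k (S + W)).mulVec u
  have hq : Measurable q :=
    measurable_const.dotProduct (hQm.matrix_mulVec measurable_const)
  have hq0 : ∀ W, 0 ≤ q W := fun W => by
    simp only [q]
    rw [← hQ.mulVec_dotProduct_mulVec]
    exact Finset.sum_nonneg fun i _ => mul_self_nonneg _
  have hq1 : ∀ W, q W ≤ 1 := fun W => by
    simp only [q]
    rw [← hQ.mulVec_dotProduct_mulVec]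
    exact hu ▸ hQ.mulVec_dotProduct_mulVec_le k (S + W) u
  let L : Matrix (Fin d) (Fin d) ℝ → ℝ := fun W =>
    -- `L` is the log-likelihood ratio of the revealed data, evaluated under the shifted law. Both
    -- quadratic forms are centred, so only the second summand contributes to its mean.
    a / 2 * (u ⬝ᵥ W.mulVec u - u ⬝ᵥ (Q k (S + W) * W * Q k (S + W)).mulVec u) +
      a ^ 2 / 4 * (1 - q W ^ 2)
  have hi1 := integrable_quadratic_goe d u
  have hi2 := hQ.integrable_revealed S k u hu
  have hiq : Integrable q (goe d) := Integrable.of_bound hq.aestronglyMeasurable 1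
    (Filter.Eventually.of_forall fun W => by rw [Real.norm_eq_abs, abs_of_nonneg (hq0 W)]; exact hq1 W)
  have hiq2 : Integrable (fun W => q W ^ 2) (goe d) :=
    Integrable.of_bound (hq.pow_const 2).aestronglyMeasurable 1
      (Filter.Eventually.of_forall fun W => by
        rw [Real.norm_eq_abs, abs_of_nonneg (sq_nonneg _)]
        exact pow_le_one₀ (hq0 W) (hq1 W))
  have hL : Integrable L (goe d) :=
    ((hi1.sub hi2).const_mul _).add (((integrable_const 1).sub hiq2).const_mul _)
  have hLint : ∫ W, L W ∂goe d ≤ a ^ 2 / 2 * ∫ W, (1 - q W) ∂goe d := by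
    have : ∫ W, L W ∂goe d = ∫ W, a ^ 2 / 4 * (1 - q W ^ 2) ∂goe d := by
      have e := integral_add ((hi1.sub hi2).const_mul (a / 2))
        (((integrable_const 1).sub hiq2).const_mul (a ^ 2 / 4))
      simp only [Pi.sub_apply] at e
      simp only [L, e]
      rw [integral_const_mul, integral_sub hi1 hi2, integral_quadratic_goe,
        hQ.integral_revealed S k u hu]
      simp
    -- Here 1 - q² ≤ 2(1 - q), which is (1 - q)² ≥ 0; this linearizes the information in the
    -- overlaps.
    rw [this, ← integral_const_mul]
    refine integral_mono (((integrable_const 1).sub hiq2).const_mul _)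
      (((integrable_const 1).sub hiq).const_mul _) fun W => ?_
    simp only
    nlinarith [mul_nonneg (sq_nonneg a) (sq_nonneg (1 - q W))]
  have hfS : Integrable (fun W => f (S + W)) (goe d) := by
    refine Integrable.of_bound (hf.comp hSm).aestronglyMeasurable |α|
      (Filter.Eventually.of_forall fun W => ?_)
    simp only [f, Set.indicator, Real.norm_eq_abs]
    split_ifs <;> simp
  have hfSint : ∫ W, f (S + W) ∂goe d = α * (goe d).real {W | S + W ∈ E} := by
    have : (fun W => f (S + W)) = Set.indicator {W | S + W ∈ E} fun _ => α := by
      ext W; simp [f, Set.indicator]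
    have hE' : MeasurableSet {W | S + W ∈ E} := hSm hE
    rw [this, integral_indicator_const _ hE', smul_eq_mul, mul_comm]
  have hexpf : ∫ W, Real.exp (f W) ∂goe d = 1 + (Real.exp α - 1) * (goe d).real E := by
    have : (fun W => Real.exp (f W)) = fun W => 1 + E.indicator (fun _ => Real.exp α - 1) W := by
      ext W
      by_cases hW : W ∈ E <;> simp [f, hW]
    rw [this, integral_add (integrable_const _) ((integrable_const _).indicator hE),
      integral_indicator_const _ hE, smul_eq_mul, mul_comm]
    simp
  have hexpfi : Integrable (fun W => Real.exp (f W)) (goe d) := by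
    refine Integrable.of_bound hf.exp.aestronglyMeasurable (Real.exp |α|)
      (Filter.Eventually.of_forall fun W => ?_)
    rw [Real.norm_eq_abs, Real.abs_exp, Real.exp_le_exp]
    simp only [f, Set.indicator]
    split_ifs
    · exact le_abs_self _
    · exact abs_nonneg _
  have hcm := hQ.lintegral_change_of_measure k a u hu
    (h := fun M => ENNReal.ofReal (Real.exp (f M))) (by fun_prop) fun M Y => by
      have : f (M + Q k M * Y * Q k M) = f M := by
        simp only [f, Set.indicator, hEQ]
      rw [this]
  have hcm' : ∫⁻ W, ENNReal.ofReal (Real.exp (f W)) ∂goe d =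
      ∫⁻ W, ENNReal.ofReal (Real.exp (f (S + W) - L W)) ∂goe d := by
    rw [hcm]
    refine lintegral_congr fun W => ?_
    rw [← ENNReal.ofReal_mul (Real.exp_pos _).le, ← Real.exp_add, sub_eq_add_neg (f (S + W))]
  have hmy : AEStronglyMeasurable (fun W => Real.exp (f (S + W) - L W)) (goe d) :=
    Real.continuous_exp.comp_aestronglyMeasurable (hfS.sub hL).aestronglyMeasurable
  have hyi : Integrable (fun W => Real.exp (f (S + W) - L W)) (goe d) := by
    refine ⟨hmy, ?_⟩
    rw [hasFiniteIntegral_iff_ofReal (Filter.Eventually.of_forall fun W => (Real.exp_pos _).le),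
      ← hcm']
    rw [← hasFiniteIntegral_iff_ofReal
      (Filter.Eventually.of_forall fun W => (Real.exp_pos _).le)]
    exact hexpfi.2
  have hyint : ∫ W, Real.exp (f (S + W) - L W) ∂goe d =
      1 + (Real.exp α - 1) * (goe d).real E := by
    rw [← hexpf, integral_eq_lintegral_of_nonneg_ae
      (Filter.Eventually.of_forall fun W => (Real.exp_pos _).le) hmy, ← hcm',
      integral_eq_lintegral_of_nonneg_ae
      (Filter.Eventually.of_forall fun W => (Real.exp_pos _).le) hexpfi.1]
  -- This is the tangent line of exp at log 2. The exponential moment will turn out to be at most 2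
  -- for the chosen α, and for that value the tangent at log 2 is the best one.
  have hpt : ∀ W, 2 * (1 + (f (S + W) - L W) - Real.log 2) ≤ Real.exp (f (S + W) - L W) :=
    fun W => by
      have h := Real.add_one_le_exp (f (S + W) - L W - Real.log 2)
      rw [Real.exp_sub _ (Real.log 2), Real.exp_log two_pos] at h
      linarith
  have hmono := integral_mono (((((integrable_const (1 : ℝ)).add (hfS.sub hL)).sub
    (integrable_const (Real.log 2))).const_mul 2)) hyi hpt
  rw [hyint, integral_const_mul] at hmono
  have : ∫ W, ((1 : ℝ) + (f (S + W) - L W) - Real.log 2) ∂goe d =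
      1 + (α * (goe d).real {W | S + W ∈ E} - ∫ W, L W ∂goe d) - Real.log 2 := by
    have e1 := integral_sub ((integrable_const (1 : ℝ)).add (hfS.sub hL))
      (integrable_const (Real.log 2))
    have e2 := integral_add (integrable_const (1 : ℝ)) (hfS.sub hL)
    simp only [Pi.add_apply, Pi.sub_apply] at e1 e2
    rw [e1, e2, integral_sub hfS hL, hfSint]
    simp
  simp only [Pi.add_apply, Pi.sub_apply] at hmono
  rw [this] at hmono
  linarith

end IsAdaptiveProj

/-! ### The directions revealed by a query algorithm -/

section GramSchmidt

open InnerProductSpace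

theorem gramSchmidt_eq_sum {E : Type*} [NormedAddCommGroup E] [InnerProductSpace ℝ E]
    (f : ℕ → E) (n : ℕ) : gramSchmidt ℝ f n = f n - ∑ i ∈ Finset.Iio n,
      (inner ℝ (gramSchmidt ℝ f i) (f n) / ‖gramSchmidt ℝ f i‖ ^ 2) • gramSchmidt ℝ f i := by
  rw [gramSchmidt_def]
  simp [Submodule.starProjection_singleton]

theorem gramSchmidt_congr {E : Type*} [NormedAddCommGroup E] [InnerProductSpace ℝ E]
    {f g : ℕ → E} (n : ℕ) (h : ∀ i ≤ n, f i = g i) : gramSchmidt ℝ f n = gramSchmidt ℝ g n := by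
  induction n using Nat.strong_induction_on with
  | _ n ih =>
    rw [gramSchmidt_eq_sum, gramSchmidt_eq_sum, h n le_rfl]
    congr 1
    refine Finset.sum_congr rfl fun i hi => ?_
    rw [Finset.mem_Iio] at hi
    rw [ih i hi fun j hj => h j (hj.trans hi.le)]

theorem gramSchmidt_eq_self {E : Type*} [NormedAddCommGroup E] [InnerProductSpace ℝ E]
    {f : ℕ → E} (n : ℕ) (h : ∀ i ≤ n, ∀ j < i, inner ℝ (f j) (f i) = 0) :
    gramSchmidt ℝ f n = f n := by
  induction n using Nat.strong_induction_on with
  | _ n ih =>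
    rw [gramSchmidt_eq_sum, Finset.sum_eq_zero, sub_zero]
    intro i hi
    rw [Finset.mem_Iio] at hi
    rw [ih i hi fun j hj => h j (hj.trans hi.le), h n le_rfl i hi]
    simp

theorem measurable_gramSchmidt {α E : Type*} [MeasurableSpace α] [NormedAddCommGroup E]
    [InnerProductSpace ℝ E] [MeasurableSpace E] [BorelSpace E] [SecondCountableTopology E]
    {f : α → ℕ → E} (hf : ∀ i, Measurable fun a => f a i) (n : ℕ) :
    Measurable fun a => gramSchmidt ℝ (f a) n := by
  induction n using Nat.strong_induction_on with
  | _ n ih =>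
    simp only [fun a => gramSchmidt_eq_sum (f a) n]
    refine (hf n).sub (Finset.measurable_sum _ fun i hi => ?_)
    rw [Finset.mem_Iio] at hi
    exact (((ih i hi).inner (hf n)).div ((ih i hi).norm.pow_const 2)).smul (ih i hi)

theorem gramSchmidtNormed_eq (E : Type*) [NormedAddCommGroup E] [InnerProductSpace ℝ E]
    (f : ℕ → E) (n : ℕ) : gramSchmidtNormed ℝ f n =
      ‖gramSchmidt ℝ f n‖⁻¹ • gramSchmidt ℝ f n := rfl

end GramSchmidt

/-! ### Projections onto the complement of an orthogonal system that may contain zero vectors. -/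

section OrthogonalSystem

variable {d : ℕ}

/-- The projection onto the orthogonal complement of the first `k` members of an orthogonal
system of vectors of norm zero or one. -/
noncomputable def complProj (n : ℕ → Fin d → ℝ) (k : ℕ) : Matrix (Fin d) (Fin d) ℝ :=
  1 - ∑ i ∈ Finset.range k, Matrix.vecMulVec (n i) (n i)

theorem complProj_congr {n m : ℕ → Fin d → ℝ} {k : ℕ} (h : ∀ i < k, n i = m i) :
    complProj n k = complProj m k := by
  simp only [complProj]
  congr 1
  exact Finset.sum_congr rfl fun i hi => by rw [h i (Finset.mem_range.1 hi)]

theorem complProj_succ (n : ℕ → Fin d → ℝ) (k : ℕ) :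
    complProj n (k + 1) = complProj n k - Matrix.vecMulVec (n k) (n k) := by
  simp [complProj, Finset.sum_range_succ, sub_sub]

theorem isSymm_complProj (n : ℕ → Fin d → ℝ) (k : ℕ) : (complProj n k).IsSymm := by
  simp [complProj, Matrix.IsSymm, Matrix.transpose_sub, Matrix.transpose_sum,
    Matrix.transpose_vecMulVec]

theorem complProj_mulVec (n : ℕ → Fin d → ℝ) (k : ℕ) (x : Fin d → ℝ) :
    (complProj n k).mulVec x = x - ∑ i ∈ Finset.range k, (n i ⬝ᵥ x) • n i := by
  simp [complProj, Matrix.sub_mulVec, Matrix.sum_mulVec, Matrix.vecMulVec_mulVec]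

theorem complProj_mulVec_of_le {n : ℕ → Fin d → ℝ} (h : ∀ i j, i ≠ j → n i ⬝ᵥ n j = 0)
    {k j : ℕ} (hj : k ≤ j) : (complProj n k).mulVec (n j) = n j := by
  rw [complProj_mulVec, Finset.sum_eq_zero, sub_zero]
  intro i hi
  rw [h i j ((Finset.mem_range.1 hi).trans_le hj).ne, zero_smul]

theorem complProj_mulVec_of_lt {n : ℕ → Fin d → ℝ} (h : ∀ i j, i ≠ j → n i ⬝ᵥ n j = 0)
    (h1 : ∀ i, (n i ⬝ᵥ n i) • n i = n i) {k j : ℕ} (hj : j < k) :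
    (complProj n k).mulVec (n j) = 0 := by
  rw [complProj_mulVec, Finset.sum_eq_single_of_mem j (Finset.mem_range.2 hj), h1, sub_self]
  intro i _ hi
  rw [h i j hi, zero_smul]

theorem complProj_mul_vecMulVec {n : ℕ → Fin d → ℝ} (h : ∀ i j, i ≠ j → n i ⬝ᵥ n j = 0) (k : ℕ) :
    complProj n k * Matrix.vecMulVec (n k) (n k) = Matrix.vecMulVec (n k) (n k) := by
  rw [Matrix.mul_vecMulVec, complProj_mulVec_of_le h le_rfl]

theorem vecMulVec_mul_complProj {n : ℕ → Fin d → ℝ} (h : ∀ i j, i ≠ j → n i ⬝ᵥ n j = 0) (k : ℕ) :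
    Matrix.vecMulVec (n k) (n k) * complProj n k = Matrix.vecMulVec (n k) (n k) := by
  have := congrArg Matrix.transpose (complProj_mul_vecMulVec h k)
  rwa [Matrix.transpose_mul, (isSymm_complProj n k : _ = _), Matrix.transpose_vecMulVec] at this

theorem complProj_mul_succ {n : ℕ → Fin d → ℝ} (h : ∀ i j, i ≠ j → n i ⬝ᵥ n j = 0) (k : ℕ)
    (hk : complProj n k * complProj n k = complProj n k) :
    complProj n k * complProj n (k + 1) = complProj n (k + 1) := by
  rw [complProj_succ, mul_sub, hk, complProj_mul_vecMulVec h]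

theorem complProj_mul_self {n : ℕ → Fin d → ℝ} (h : ∀ i j, i ≠ j → n i ⬝ᵥ n j = 0)
    (h1 : ∀ i, (n i ⬝ᵥ n i) • n i = n i) (k : ℕ) :
    complProj n k * complProj n k = complProj n k := by
  induction k with
  | zero => simp [complProj]
  | succ k ih =>
    have hX : Matrix.vecMulVec (n k) (n k) * Matrix.vecMulVec (n k) (n k) =
        Matrix.vecMulVec (n k) (n k) := by
      rw [Matrix.mul_vecMulVec, Matrix.vecMulVec_mulVec]
      simp [h1]
    rw [complProj_succ, sub_mul, mul_sub, mul_sub, ih, complProj_mul_vecMulVec h,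
      vecMulVec_mul_complProj h, hX]
    abel

theorem dotProduct_complProj_mulVec (n : ℕ → Fin d → ℝ) (k : ℕ) (x : Fin d → ℝ) :
    x ⬝ᵥ (complProj n k).mulVec x = x ⬝ᵥ x - ∑ i ∈ Finset.range k, (n i ⬝ᵥ x) ^ 2 := by
  rw [complProj_mulVec, dotProduct_sub, dotProduct_sum]
  congr 1
  refine Finset.sum_congr rfl fun i _ => ?_
  rw [dotProduct_smul, smul_eq_mul, dotProduct_comm x, sq]

theorem measurable_complProj {α : Type*} [MeasurableSpace α] {f : α → ℕ → Fin d → ℝ}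
    (hf : ∀ i, Measurable fun x => f x i) (k : ℕ) : Measurable fun x => complProj (f x) k := by
  refine measurable_matrix fun a b => ?_
  simp only [complProj, Matrix.sub_apply, Matrix.sum_apply]
  exact measurable_const.sub (Finset.measurable_sum _ fun i _ =>
    ((hf i).matrix_vecMulVec (hf i)).matrix_apply a b)

end OrthogonalSystem

/-! ### Runs of the algorithm as functions of the revealed directions. -/

namespace QueryAlg

variable {d T : ℕ} {Ξ : Type*} [MeasurableSpace Ξ] (A : QueryAlg d T Ξ)

theorem measurable_vec_of_history (i : ℕ)
    (h : Measurable fun p : Ξ × Matrix (Fin d) (Fin d) ℝ => A.history p.1 p.2 i) :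
    Measurable fun p : Ξ × Matrix (Fin d) (Fin d) ℝ => A.vec p.1 p.2 i :=
  (A.measurable_next i).comp (measurable_fst.prodMk h)

theorem measurable_history (i : ℕ) :
    Measurable fun p : Ξ × Matrix (Fin d) (Fin d) ℝ => A.history p.1 p.2 i := by
  induction i with
  | zero => exact measurable_pi_lambda _ fun j => j.elim0
  | succ i ih =>
    refine measurable_pi_lambda _ fun j => ?_
    have hv := A.measurable_vec_of_history i ih
    refine Fin.lastCases ?_ (fun j => ?_) j
    · simp only [history, Fin.snoc_last]
      refine hv.prodMk ((WithLp.measurable_toLp 2 _).comp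
        (measurable_snd.matrix_mulVec ((WithLp.measurable_ofLp 2 _).comp hv)))
    · simp only [history, Fin.snoc_castSucc]
      exact (measurable_pi_apply j).comp ih

theorem measurable_vec (i : ℕ) :
    Measurable fun p : Ξ × Matrix (Fin d) (Fin d) ℝ => A.vec p.1 p.2 i :=
  A.measurable_vec_of_history i (A.measurable_history i)

/-- The `i`-th query, orthonormalized against the previous ones. -/
noncomputable def dir (ξ : Ξ) (M : Matrix (Fin d) (Fin d) ℝ) (i : ℕ) : EuclideanSpace ℝ (Fin d) :=
  InnerProductSpace.gramSchmidtNormed ℝ (A.vec ξ M) i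

theorem measurable_dir (i : ℕ) :
    Measurable fun p : Ξ × Matrix (Fin d) (Fin d) ℝ => A.dir p.1 p.2 i := by
  have h := measurable_gramSchmidt (f := fun p : Ξ × Matrix (Fin d) (Fin d) ℝ => A.vec p.1 p.2)
    A.measurable_vec i
  exact h.norm.inv.smul h

theorem inner_dir_of_ne (ξ : Ξ) (M : Matrix (Fin d) (Fin d) ℝ) {i j : ℕ} (h : i ≠ j) :
    inner ℝ (A.dir ξ M i) (A.dir ξ M j) = 0 := by
  simp only [dir, gramSchmidtNormed_eq, real_inner_smul_left, real_inner_smul_right]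
  rw [InnerProductSpace.gramSchmidt_orthogonal ℝ _ h]
  simp

theorem norm_dir (ξ : Ξ) (M : Matrix (Fin d) (Fin d) ℝ) (i : ℕ) :
    A.dir ξ M i = 0 ∨ ‖A.dir ξ M i‖ = 1 :=
  or_iff_not_imp_left.2 fun h => InnerProductSpace.gramSchmidtNormed_unit_length' h

theorem norm_dir_le (ξ : Ξ) (M : Matrix (Fin d) (Fin d) ℝ) (i : ℕ) : ‖A.dir ξ M i‖ ≤ 1 := by
  rcases A.norm_dir ξ M i with h | h
  · simp [h]
  · exact h.le

theorem _root_.EuclideanSpace.inner_eq_dotProduct (x y : EuclideanSpace ℝ (Fin d)) :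
    inner ℝ x y = x.ofLp ⬝ᵥ y.ofLp := by
  rw [EuclideanSpace.inner_eq_star_dotProduct, star_trivial, dotProduct_comm]

theorem dir_dotProduct_of_ne (ξ : Ξ) (M : Matrix (Fin d) (Fin d) ℝ) (i j : ℕ) (h : i ≠ j) :
    (A.dir ξ M i).ofLp ⬝ᵥ (A.dir ξ M j).ofLp = 0 := by
  rw [← EuclideanSpace.inner_eq_dotProduct, A.inner_dir_of_ne ξ M h]

theorem dir_dotProduct_smul_self (ξ : Ξ) (M : Matrix (Fin d) (Fin d) ℝ) (i : ℕ) :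
    ((A.dir ξ M i).ofLp ⬝ᵥ (A.dir ξ M i).ofLp) • (A.dir ξ M i).ofLp = (A.dir ξ M i).ofLp := by
  rw [← EuclideanSpace.inner_eq_dotProduct, real_inner_self_eq_norm_sq]
  rcases A.norm_dir ξ M i with h | h <;> simp [h]

theorem vec_mem_span_dir (ξ : Ξ) (M : Matrix (Fin d) (Fin d) ℝ) (i : ℕ) :
    A.vec ξ M i ∈ Submodule.span ℝ (A.dir ξ M '' Set.Iic i) := by
  have h := InnerProductSpace.mem_span_gramSchmidt ℝ (A.vec ξ M) (le_refl i)
  rwa [← InnerProductSpace.span_gramSchmidtNormed] at h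

/-- `M'` acts as `M` on the first `k` directions of the run on `M`. -/
def Agree (k : ℕ) (ξ : Ξ) (M M' : Matrix (Fin d) (Fin d) ℝ) : Prop :=
  ∀ j < k, M'.mulVec (A.dir ξ M j).ofLp = M.mulVec (A.dir ξ M j).ofLp

variable {A}

theorem Agree.mulVec_vec {k : ℕ} {ξ : Ξ} {M M' : Matrix (Fin d) (Fin d) ℝ}
    (h : A.Agree k ξ M M') {i : ℕ} (hi : i < k) :
    M'.mulVec (A.vec ξ M i).ofLp = M.mulVec (A.vec ξ M i).ofLp := by
  refine Submodule.span_induction (p := fun x _ => M'.mulVec x.ofLp = M.mulVec x.ofLp)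
    ?_ ?_ ?_ ?_ (A.vec_mem_span_dir ξ M i)
  · rintro _ ⟨j, hj, rfl⟩
    exact h j (lt_of_le_of_lt hj hi)
  · simp
  · intro x y _ _ hx hy
    simp [Matrix.mulVec_add, hx, hy]
  · intro c x _ hx
    simp [Matrix.mulVec_smul, hx]

/-- Each query lies in the span of the directions up to it, so by linearity two inputs that agree on
the directions give the same responses; induction on the round keeps the two runs equal. Agreement
on k directions also fixes the next vector, of index k, since it depends only on earlier responses.
-/
theorem Agree.history_eq {k : ℕ} {ξ : Ξ} {M M' : Matrix (Fin d) (Fin d) ℝ}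
    (h : A.Agree k ξ M M') {i : ℕ} (hi : i ≤ k) : A.history ξ M' i = A.history ξ M i := by
  induction i with
  | zero => rfl
  | succ i ih =>
    have h1 := ih (Nat.le_of_succ_le hi)
    have h2 := h.mulVec_vec hi
    simp only [vec] at h2
    simp only [history]
    rw [h1, h2]

theorem Agree.vec_eq {k : ℕ} {ξ : Ξ} {M M' : Matrix (Fin d) (Fin d) ℝ}
    (h : A.Agree k ξ M M') {i : ℕ} (hi : i ≤ k) : A.vec ξ M' i = A.vec ξ M i := by
  simp only [vec, h.history_eq hi]

theorem Agree.dir_eq {k : ℕ} {ξ : Ξ} {M M' : Matrix (Fin d) (Fin d) ℝ}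
    (h : A.Agree k ξ M M') {i : ℕ} (hi : i ≤ k) : A.dir ξ M' i = A.dir ξ M i := by
  simp only [dir, gramSchmidtNormed_eq]
  rw [gramSchmidt_congr i fun j hj => h.vec_eq (hj.trans hi)]

variable (A)

/-- The projection onto the orthogonal complement of the first `k` queries on input `s • N`. -/
noncomputable def unrevealed (s : ℝ) (ξ : Ξ) (k : ℕ) (N : Matrix (Fin d) (Fin d) ℝ) :
    Matrix (Fin d) (Fin d) ℝ :=
  complProj (fun i => (A.dir ξ (s • N) i).ofLp) k

theorem agree_unrevealed (s : ℝ) (ξ : Ξ) (k : ℕ) (N Y : Matrix (Fin d) (Fin d) ℝ) :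
    A.Agree k ξ (s • N) (s • (N + A.unrevealed s ξ k N * Y * A.unrevealed s ξ k N)) := by
  intro j hj
  have : (A.unrevealed s ξ k N).mulVec (A.dir ξ (s • N) j).ofLp = 0 :=
    complProj_mulVec_of_lt (n := fun i => (A.dir ξ (s • N) i).ofLp)
      (A.dir_dotProduct_of_ne ξ _) (A.dir_dotProduct_smul_self ξ _) hj
  rw [smul_add, Matrix.add_mulVec, Matrix.smul_mulVec _ (_ * _), ← Matrix.mulVec_mulVec, this]
  simp

theorem measurable_dir_comp {α : Type*} [MeasurableSpace α] {f : α → Ξ}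
    {g : α → Matrix (Fin d) (Fin d) ℝ} (hf : Measurable f) (hg : Measurable g) (i : ℕ) :
    Measurable fun a => A.dir (f a) (g a) i := by
  have h := (A.measurable_dir i).comp (hf.prodMk hg)
  exact h

theorem measurable_unrevealed (s : ℝ) (ξ : Ξ) (k : ℕ) : Measurable (A.unrevealed s ξ k) := by
  have h : ∀ i, Measurable fun N : Matrix (Fin d) (Fin d) ℝ => (A.dir ξ (s • N) i).ofLp :=
    fun i => (WithLp.measurable_ofLp 2 (Fin d → ℝ)).comp (A.measurable_dir_comp
      measurable_const (measurable_const.matrix_smul measurable_id) i)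
  exact measurable_complProj h k

/-- Gram–Schmidt gives orthogonal directions on every input, symmetric or not, and a dependent query
contributes the zero vector. Hence the perturbation Y can be arbitrary. -/
theorem isAdaptiveProj_unrevealed (s : ℝ) (ξ : Ξ) : IsAdaptiveProj (A.unrevealed s ξ) where
  measurable := A.measurable_unrevealed s ξ
  zero M := by simp [unrevealed, complProj]
  isSymm k M := isSymm_complProj _ k
  mul_self k M :=
    complProj_mul_self (A.dir_dotProduct_of_ne ξ _) (A.dir_dotProduct_smul_self ξ _) k
  mul_succ k M := complProj_mul_succ (A.dir_dotProduct_of_ne ξ _) k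
    (complProj_mul_self (A.dir_dotProduct_of_ne ξ _) (A.dir_dotProduct_smul_self ξ _) k)
  congr_self k M Y := complProj_congr fun i hi => by
    rw [(A.agree_unrevealed s ξ k M Y).dir_eq hi.le]
  congr_succ k M Y := complProj_congr fun i hi => by
    rw [(A.agree_unrevealed s ξ k M Y).dir_eq (Nat.lt_succ_iff.1 hi)]

theorem dir_eq_vec {A : QueryAlg d T Ξ} (hA : A.OrthonormalQueries) (ξ : Ξ)
    {M : Matrix (Fin d) (Fin d) ℝ} (hM : M.IsSymm) {i : ℕ} (hi : i < T) :
    A.dir ξ M i = A.vec ξ M i := by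
  have ho := hA ξ M hM
  have h1 : InnerProductSpace.gramSchmidt ℝ (A.vec ξ M) i = A.vec ξ M i :=
    gramSchmidt_eq_self i fun a ha b hb => ho.2 (i := ⟨b, by omega⟩) (j := ⟨a, by omega⟩)
      (by simp; omega)
  have h2 : ‖A.vec ξ M i‖ = 1 := ho.1 ⟨i, hi⟩
  rw [dir, gramSchmidtNormed_eq, h1, h2]
  simp

end QueryAlg

/-! ### Averaging over the prior, the seed and the matrix -/

section Joint

variable {d : ℕ}

theorem integral_indicator_const_one {α : Type*} [MeasurableSpace α] {μ : Measure α} {s : Set α}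
    (hs : MeasurableSet s) : ∫ x, s.indicator (fun _ => (1 : ℝ)) x ∂μ = μ.real s :=
  integral_indicator_one hs

variable {Ξ : Type*} [MeasurableSpace Ξ]

/-- The observed matrix, as a function of the spike `u` and of the noise `W`. -/
noncomputable def observed (lam : ℝ) (u : EuclideanSpace ℝ (Fin d))
    (W : Matrix (Fin d) (Fin d) ℝ) : Matrix (Fin d) (Fin d) ℝ :=
  (1 / Real.sqrt d) • ((lam * Real.sqrt d) • Matrix.vecMulVec u.ofLp u.ofLp + W)

/-- The joint law of the spike, the seed and the noise. -/
noncomputable def jointLaw (P : Measure (EuclideanSpace ℝ (Fin d))) (ν : Measure Ξ) :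
    Measure ((EuclideanSpace ℝ (Fin d) × Ξ) × Matrix (Fin d) (Fin d) ℝ) :=
  (P.prod ν).prod (goe d)

/-- The scaled squared overlap of the spike with a vector computed from the observed matrix. -/
noncomputable def overlap (lam : ℝ)
    (y : Ξ → Matrix (Fin d) (Fin d) ℝ → EuclideanSpace ℝ (Fin d))
    (q : (EuclideanSpace ℝ (Fin d) × Ξ) × Matrix (Fin d) (Fin d) ℝ) : ℝ :=
  d * (inner ℝ (y q.1.2 (observed lam q.1.1 q.2)) q.1.1) ^ 2

theorem measurable_observed (lam : ℝ) :
    Measurable fun q : EuclideanSpace ℝ (Fin d) × Matrix (Fin d) (Fin d) ℝ =>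
      observed lam q.1 q.2 := by
  have h : Measurable fun q : EuclideanSpace ℝ (Fin d) × Matrix (Fin d) (Fin d) ℝ => q.1.ofLp :=
    (WithLp.measurable_ofLp 2 _).comp measurable_fst
  exact measurable_const.matrix_smul
    ((measurable_const.matrix_smul (h.matrix_vecMulVec h)).matrix_add measurable_snd)

theorem measurable_observed_comp {α : Type*} [MeasurableSpace α] (lam : ℝ)
    {f : α → EuclideanSpace ℝ (Fin d)} {g : α → Matrix (Fin d) (Fin d) ℝ} (hf : Measurable f)
    (hg : Measurable g) : Measurable fun a => observed lam (f a) (g a) := by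
  have h := (measurable_observed lam).comp (hf.prodMk hg)
  exact h

/-- With 1/√d outside, the noise is an unscaled GOE matrix and the shift has size a = λ√d. This is
the source of the factor d in the information a²/2 · E(1 - q). -/
theorem spikedLaw_eq_map (hd : 0 < d) (lam : ℝ) (u : EuclideanSpace ℝ (Fin d)) :
    spikedLaw d lam u = (goe d).map (observed lam u) := by
  have hs : Real.sqrt d ≠ 0 := (Real.sqrt_pos.2 (by exact_mod_cast hd)).ne'
  unfold spikedLaw
  congr 1
  funext W
  rw [observed, smul_add, smul_smul]
  congr 2
  field_simp

theorem measurable_observed_right (lam : ℝ) (u : EuclideanSpace ℝ (Fin d)) :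
    Measurable (observed lam u) :=
  measurable_observed_comp lam measurable_const measurable_id

theorem isProbabilityMeasure_spikedLaw (hd : 0 < d) (lam : ℝ) (u : EuclideanSpace ℝ (Fin d)) :
    IsProbabilityMeasure (spikedLaw d lam u) := by
  rw [spikedLaw_eq_map hd]
  exact Measure.isProbabilityMeasure_map (measurable_observed_right lam u).aemeasurable

/-- Orthonormality of the queries is assumed on symmetric inputs only, so queries and directions are
identified almost surely. -/
theorem isSymm_ae_spikedLaw (lam : ℝ) (u : EuclideanSpace ℝ (Fin d)) :
    ∀ᵐ M ∂spikedLaw d lam u, M.IsSymm := by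
  have hm : Measurable fun W : Matrix (Fin d) (Fin d) ℝ =>
      lam • Matrix.vecMulVec u.ofLp u.ofLp + (1 / Real.sqrt d) • W :=
    measurable_const.matrix_add (measurable_const.matrix_smul measurable_id)
  rw [spikedLaw, ae_map_iff hm.aemeasurable (measurableSet_isSymm d)]
  filter_upwards [isSymm_ae_goe d] with W hW
  exact Matrix.IsSymm.add (Matrix.IsSymm.smul (Matrix.transpose_vecMulVec _ _) _)
    (Matrix.IsSymm.smul hW _)

theorem overlap_nonneg {Ξ : Type*} (lam : ℝ)
    {y : Ξ → Matrix (Fin d) (Fin d) ℝ → EuclideanSpace ℝ (Fin d)}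
    (q : (EuclideanSpace ℝ (Fin d) × Ξ) × Matrix (Fin d) (Fin d) ℝ) :
    0 ≤ overlap lam y q := by
  unfold overlap; positivity

theorem mul_inner_sq_le {v u : EuclideanSpace ℝ (Fin d)} (hv : ‖v‖ ≤ 1) (hu : ‖u‖ = 1) :
    d * (inner ℝ v u) ^ 2 ≤ d := by
  have h := abs_real_inner_le_norm v u
  rw [hu, mul_one] at h
  have h1 : (inner ℝ v u) ^ 2 ≤ 1 := (sq_le_one_iff_abs_le_one _).2 (h.trans hv)
  have h2 : (0 : ℝ) ≤ d := Nat.cast_nonneg d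
  nlinarith

variable {P : Measure (EuclideanSpace ℝ (Fin d))} (ν : Measure Ξ)

theorem ae_norm_eq_one_jointLaw [SFinite ν] (hP : ∀ᵐ u ∂P, ‖u‖ = 1) :
    ∀ᵐ q ∂jointLaw P ν, ‖q.1.1‖ = 1 :=
  (Measure.quasiMeasurePreserving_fst (μ := P.prod ν) (ν := goe d)).ae
    ((Measure.quasiMeasurePreserving_fst (μ := P) (ν := ν)).ae hP)

theorem overlap_le_ae [SFinite ν] (hP : ∀ᵐ u ∂P, ‖u‖ = 1) (lam : ℝ)
    {y : Ξ → Matrix (Fin d) (Fin d) ℝ → EuclideanSpace ℝ (Fin d)} (hy1 : ∀ ξ M, ‖y ξ M‖ ≤ 1) :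
    ∀ᵐ q ∂jointLaw P ν, overlap lam y q ≤ d := by
  filter_upwards [ae_norm_eq_one_jointLaw ν hP] with q hq using mul_inner_sq_le (hy1 _ _) hq

variable [IsProbabilityMeasure P] [IsProbabilityMeasure ν]

instance isProbabilityMeasure_jointLaw : IsProbabilityMeasure (jointLaw P ν) := by
  unfold jointLaw; infer_instance

theorem integral_spikedLaw_eq_integral_jointLaw (hd : 0 < d) (hP : ∀ᵐ u ∂P, ‖u‖ = 1) (lam C : ℝ)
    {g : EuclideanSpace ℝ (Fin d) → Ξ → Matrix (Fin d) (Fin d) ℝ → ℝ}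
    (hg : Measurable fun q : (EuclideanSpace ℝ (Fin d) × Ξ) × Matrix (Fin d) (Fin d) ℝ =>
      g q.1.1 q.1.2 q.2)
    (hC : ∀ u ξ M, ‖u‖ = 1 → |g u ξ M| ≤ C) :
    ∫ u, ∫ p, g u p.2 p.1 ∂((spikedLaw d lam u).prod ν) ∂P =
      ∫ q, g q.1.1 q.1.2 (observed lam q.1.1 q.2) ∂jointLaw P ν := by
  have hobs : Measurable fun q : (EuclideanSpace ℝ (Fin d) × Ξ) × Matrix (Fin d) (Fin d) ℝ =>
      (q.1, observed lam q.1.1 q.2) :=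
    measurable_fst.prodMk
      (measurable_observed_comp lam (measurable_fst.comp measurable_fst) measurable_snd)
  have hint : Integrable (fun q => g q.1.1 q.1.2 (observed lam q.1.1 q.2)) (jointLaw P ν) := by
    have hgo := hg.comp hobs
    refine Integrable.of_bound hgo.aestronglyMeasurable C ?_
    filter_upwards [ae_norm_eq_one_jointLaw ν hP] with q hq using hC _ _ _ hq
  unfold jointLaw at hint ⊢
  rw [integral_prod _ hint, integral_prod _ hint.integral_prod_left]
  refine integral_congr_ae ?_
  filter_upwards [hP] with u hu
  have := isProbabilityMeasure_spikedLaw hd lam u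
  have hgu : Measurable fun p : Matrix (Fin d) (Fin d) ℝ × Ξ => g u p.2 p.1 :=
    hg.comp ((measurable_const.prodMk measurable_snd).prodMk measurable_fst)
  have hgi : Integrable (fun p : Matrix (Fin d) (Fin d) ℝ × Ξ => g u p.2 p.1)
      ((spikedLaw d lam u).prod ν) :=
    Integrable.of_bound hgu.aestronglyMeasurable C
      (Filter.Eventually.of_forall fun p => hC _ _ _ hu)
  rw [integral_prod_symm _ hgi]
  refine integral_congr_ae (Filter.Eventually.of_forall fun ξ => ?_)
  simp only
  rw [spikedLaw_eq_map hd, integral_map (measurable_observed_right lam u).aemeasurable]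
  exact (hgu.comp measurable_prodMk_right).aestronglyMeasurable

variable {y : Ξ → Matrix (Fin d) (Fin d) ℝ → EuclideanSpace ℝ (Fin d)}

theorem measurable_mul_inner_sq
    (hy : Measurable fun p : Ξ × Matrix (Fin d) (Fin d) ℝ => y p.1 p.2) :
    Measurable fun q : (EuclideanSpace ℝ (Fin d) × Ξ) × Matrix (Fin d) (Fin d) ℝ =>
      d * (inner ℝ (y q.1.2 q.2) q.1.1) ^ 2 := by
  have h : Measurable fun q : (EuclideanSpace ℝ (Fin d) × Ξ) × Matrix (Fin d) (Fin d) ℝ =>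
      y q.1.2 q.2 := hy.comp ((measurable_snd.comp measurable_fst).prodMk measurable_snd)
  exact ((h.inner (measurable_fst.comp measurable_fst)).pow_const 2).const_mul _

theorem measurable_overlap (lam : ℝ)
    (hy : Measurable fun p : Ξ × Matrix (Fin d) (Fin d) ℝ => y p.1 p.2) :
    Measurable (overlap lam y) := by
  have hobs : Measurable fun q : (EuclideanSpace ℝ (Fin d) × Ξ) × Matrix (Fin d) (Fin d) ℝ =>
      (q.1, observed lam q.1.1 q.2) :=
    measurable_fst.prodMk
      (measurable_observed_comp lam (measurable_fst.comp measurable_fst) measurable_snd)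
  have h := (measurable_mul_inner_sq hy).comp hobs
  exact h

theorem integrable_overlap (hP : ∀ᵐ u ∂P, ‖u‖ = 1) (lam : ℝ)
    (hy : Measurable fun p : Ξ × Matrix (Fin d) (Fin d) ℝ => y p.1 p.2)
    (hy1 : ∀ ξ M, ‖y ξ M‖ ≤ 1) : Integrable (overlap lam y) (jointLaw P ν) := by
  refine Integrable.of_bound (measurable_overlap lam hy).aestronglyMeasurable d ?_
  filter_upwards [overlap_le_ae ν hP lam hy1] with q hq
  rwa [Real.norm_eq_abs, abs_of_nonneg (overlap_nonneg lam q)]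

theorem integral_mul_inner_sq_eq (hd : 0 < d) (hP : ∀ᵐ u ∂P, ‖u‖ = 1) (lam : ℝ)
    (hy : Measurable fun p : Ξ × Matrix (Fin d) (Fin d) ℝ => y p.1 p.2)
    (hy1 : ∀ ξ M, ‖y ξ M‖ ≤ 1) :
    ∫ u, ∫ p, d * (inner ℝ (y p.2 p.1) u) ^ 2 ∂((spikedLaw d lam u).prod ν) ∂P =
      ∫ q, overlap lam y q ∂jointLaw P ν := by
  have h := integral_spikedLaw_eq_integral_jointLaw ν hd hP lam d
    (g := fun u ξ M => d * (inner ℝ (y ξ M) u) ^ 2) (measurable_mul_inner_sq hy)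
    fun u ξ M hu => by
      rw [abs_of_nonneg (by positivity)]
      exact mul_inner_sq_le (hy1 ξ M) hu
  exact h

theorem integral_tail_eq (hd : 0 < d) (hP : ∀ᵐ u ∂P, ‖u‖ = 1) (lam t : ℝ)
    (hy : Measurable fun p : Ξ × Matrix (Fin d) (Fin d) ℝ => y p.1 p.2) :
    ∫ u, ((spikedLaw d lam u).prod ν).real {p | t ≤ d * (inner ℝ (y p.2 p.1) u) ^ 2} ∂P =
      (jointLaw P ν).real {q | t ≤ overlap lam y q} := by
  have hm := measurable_mul_inner_sq hy
  have hI : Measurable ((Set.Ici t).indicator fun _ => (1 : ℝ)) :=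
    measurable_const.indicator measurableSet_Ici
  have hIm := hI.comp hm
  have h := integral_spikedLaw_eq_integral_jointLaw ν hd hP lam 1
    (g := fun u ξ M => Set.indicator (Set.Ici t) (fun _ => (1 : ℝ)) (d * (inner ℝ (y ξ M) u) ^ 2))
    hIm
    fun u ξ M hu => by
      simp only [Set.indicator]
      split_ifs <;> simp
  have h2 : ∀ q, (Set.Ici t).indicator (fun _ => (1 : ℝ))
      (d * (inner ℝ (y q.1.2 (observed lam q.1.1 q.2)) q.1.1) ^ 2) =
      Set.indicator {q | t ≤ overlap lam y q} (fun _ => (1 : ℝ)) q := fun q => rfl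
  simp only [h2] at h
  rw [integral_indicator_const_one (measurableSet_le measurable_const (measurable_overlap lam hy))] at h
  rw [← h]
  congr 1
  funext u
  have h3 : ∀ p : Matrix (Fin d) (Fin d) ℝ × Ξ,
      (Set.Ici t).indicator (fun _ => (1 : ℝ)) (d * (inner ℝ (y p.2 p.1) u) ^ 2) =
      Set.indicator {p : Matrix (Fin d) (Fin d) ℝ × Ξ | t ≤ d * (inner ℝ (y p.2 p.1) u) ^ 2}
        (fun _ => (1 : ℝ)) p := fun p => rfl
  simp only [h3]
  have hpm : Measurable fun p : Matrix (Fin d) (Fin d) ℝ × Ξ => ((u, p.2), p.1) :=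
    (measurable_const.prodMk measurable_snd).prodMk measurable_fst
  have hmu := hm.comp hpm
  have hSu : MeasurableSet {p : Matrix (Fin d) (Fin d) ℝ × Ξ |
      t ≤ d * (inner ℝ (y p.2 p.1) u) ^ 2} := measurableSet_le measurable_const hmu
  rw [integral_indicator_const_one hSu]

end Joint

/-! ### The prior against vectors computed from pure noise. -/

section Prior

variable {d : ℕ} {Ξ : Type*} [MeasurableSpace Ξ] {C₁ C₂ : ℝ}
  {P : Measure (EuclideanSpace ℝ (Fin d))}

theorem IsotropicTailPrior.pos (hP : IsotropicTailPrior d C₁ C₂ P) : 0 < d := by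
  have := hP.isProbabilityMeasure
  obtain ⟨u, hu⟩ := hP.ae_norm_eq_one.exists
  rcases Nat.eq_zero_or_pos d with rfl | h
  · rw [Subsingleton.elim u 0, norm_zero] at hu
    exact absurd hu zero_ne_one
  · exact h

/-- Normalizing a shorter vector only increases its overlap. The zero vector is needed because a
linearly dependent query has direction zero. -/
theorem IsotropicTailPrior.tail_le (hP : IsotropicTailPrior d C₁ C₂ P)
    {v : EuclideanSpace ℝ (Fin d)} (hv : ‖v‖ ≤ 1) {t : ℝ} (ht : 0 < t) :
    P.real {u | t ≤ d * (inner ℝ v u) ^ 2} ≤ Real.exp (C₂ - C₁ * t) := by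
  have := hP.isProbabilityMeasure
  rcases eq_or_ne v 0 with rfl | h0
  · have : {u : EuclideanSpace ℝ (Fin d) | t ≤ d * (inner ℝ 0 u) ^ 2} = ∅ := by
      ext u; simp [ht]
    rw [this, measureReal_empty]
    positivity
  · have hn : 0 < ‖v‖ := norm_pos_iff.2 h0
    refine le_trans (measureReal_mono ?_)
      (hP.tail (‖v‖⁻¹ • v) (by rw [norm_smul, norm_inv, norm_norm, inv_mul_cancel₀ hn.ne']) t ht.le)
    intro u hu
    refine le_trans (b := d * (inner ℝ v u) ^ 2) hu ?_
    rw [real_inner_smul_left, mul_pow]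
    have : 1 ≤ (‖v‖⁻¹) ^ 2 := one_le_pow₀ ((one_le_inv₀ hn).2 hv)
    gcongr
    exact le_mul_of_one_le_left (sq_nonneg _) this

/-- A vector of norm at most one that is computed from the seed and from pure noise is unlikely to
have a large overlap with the spike. -/
theorem IsotropicTailPrior.null_tail_le (hP : IsotropicTailPrior d C₁ C₂ P) (ν : Measure Ξ)
    [IsProbabilityMeasure ν] {y : Ξ → Matrix (Fin d) (Fin d) ℝ → EuclideanSpace ℝ (Fin d)}
    (hy : Measurable fun p : Ξ × Matrix (Fin d) (Fin d) ℝ => y p.1 p.2)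
    (hy1 : ∀ ξ M, ‖y ξ M‖ ≤ 1) {t : ℝ} (ht : 0 < t) :
    ∫ x, (goe d).real {W | t ≤ d * (inner ℝ (y x.2 W) x.1) ^ 2} ∂(P.prod ν) ≤
      Real.exp (C₂ - C₁ * t) := by
  have := hP.isProbabilityMeasure
  have hm := measurable_mul_inner_sq hy
  have hS : MeasurableSet {q : (EuclideanSpace ℝ (Fin d) × Ξ) × Matrix (Fin d) (Fin d) ℝ |
      t ≤ d * (inner ℝ (y q.1.2 q.2) q.1.1) ^ 2} := measurableSet_le measurable_const hm
  set S := {q : (EuclideanSpace ℝ (Fin d) × Ξ) × Matrix (Fin d) (Fin d) ℝ |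
      t ≤ d * (inner ℝ (y q.1.2 q.2) q.1.1) ^ 2} with hSdef
  have hint : Integrable (S.indicator (fun _ => (1 : ℝ))) ((P.prod ν).prod (goe d)) :=
    (integrable_const (1 : ℝ)).indicator hS
  have e1 : ∀ x : EuclideanSpace ℝ (Fin d) × Ξ,
      (goe d).real {W | t ≤ d * (inner ℝ (y x.2 W) x.1) ^ 2} =
        ∫ W, S.indicator (fun _ => (1 : ℝ)) (x, W) ∂goe d := fun x => by
    have : ∀ W, S.indicator (fun _ => (1 : ℝ)) (x, W) =
        Set.indicator {W | t ≤ d * (inner ℝ (y x.2 W) x.1) ^ 2} (fun _ => (1 : ℝ)) W := fun W => rfl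
    simp only [this]
    have hSx : MeasurableSet {W | t ≤ d * (inner ℝ (y x.2 W) x.1) ^ 2} :=
      measurable_prodMk_left (x := x) hS
    rw [integral_indicator_const_one hSx]
  simp only [e1]
  -- Fubini puts the integral over u innermost: for fixed seed and noise the vector is constant, and
  -- the tail of the prior applies.
  rw [← integral_prod _ hint, integral_prod_symm _ hint]
  refine (integral_mono_of_nonneg (Filter.Eventually.of_forall fun W => integral_nonneg fun x =>
    Set.indicator_nonneg (fun _ _ => zero_le_one) _)
    (integrable_const (Real.exp (C₂ - C₁ * t))) (Filter.Eventually.of_forall fun W => ?_)).trans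
    (by simp)
  have hSW : MeasurableSet ((fun x : EuclideanSpace ℝ (Fin d) × Ξ => (x, W)) ⁻¹' S) :=
    measurable_prodMk_right hS
  have hint2 : Integrable (fun x : EuclideanSpace ℝ (Fin d) × Ξ => S.indicator (fun _ => (1 : ℝ)) (x, W))
      (P.prod ν) := (integrable_const (1 : ℝ)).indicator hSW
  simp only
  rw [integral_prod_symm _ hint2]
  refine (integral_mono_of_nonneg (Filter.Eventually.of_forall fun ξ => integral_nonneg fun x =>
    Set.indicator_nonneg (fun _ _ => zero_le_one) _)
    (integrable_const (Real.exp (C₂ - C₁ * t))) (Filter.Eventually.of_forall fun ξ => ?_)).trans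
    (by simp)
  have e2 : ∀ u : EuclideanSpace ℝ (Fin d), S.indicator (fun _ => (1 : ℝ)) ((u, ξ), W) =
      Set.indicator {u | t ≤ d * (inner ℝ (y ξ W) u) ^ 2} (fun _ => (1 : ℝ)) u := fun u => rfl
  simp only [e2]
  have hSu : MeasurableSet {u | t ≤ d * (inner ℝ (y ξ W) u) ^ 2} :=
    measurable_prodMk_right (y := ξ) hSW
  rw [integral_indicator_const_one hSu]
  exact hP.tail_le (hy1 ξ W) ht

end Prior

/-! ### The tail bound for vectors computed from the revealed data. -/

namespace QueryAlg

variable {d T : ℕ} {Ξ : Type*} [MeasurableSpace Ξ]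

/-- A measurable vector of norm at most one, computed from the seed and from the responses to the
first `k` queries. -/
structure Revealed (A : QueryAlg d T Ξ) (k : ℕ)
    (y : Ξ → Matrix (Fin d) (Fin d) ℝ → EuclideanSpace ℝ (Fin d)) : Prop where
  measurable : Measurable fun p : Ξ × Matrix (Fin d) (Fin d) ℝ => y p.1 p.2
  norm_le : ∀ ξ M, ‖y ξ M‖ ≤ 1
  congr : ∀ ξ M M', A.Agree k ξ M M' → y ξ M' = y ξ M

theorem revealed_dir (A : QueryAlg d T Ξ) (k : ℕ) : A.Revealed k fun ξ M => A.dir ξ M k :=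
  ⟨A.measurable_dir k, fun ξ M => A.norm_dir_le ξ M k, fun _ _ _ h => h.dir_eq le_rfl⟩

theorem revealed_output (A : QueryAlg d T Ξ) : A.Revealed T fun ξ M => A.vec ξ M T :=
  ⟨A.measurable_vec T, fun _ _ => (A.norm_output _ _).le, fun _ _ _ h => h.vec_eq le_rfl⟩

/-- The bound on the information revealed by the first `k` directions. -/
noncomputable def dirInfo (A : QueryAlg d T Ξ) (lam : ℝ) (P : Measure (EuclideanSpace ℝ (Fin d)))
    (ν : Measure Ξ) (k : ℕ) : ℝ :=
  Real.log 2 + lam ^ 2 / 2 * ∑ i ∈ Finset.range k,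
    ∫ q, overlap lam (fun ξ M => A.dir ξ M i) q ∂jointLaw P ν

theorem fano (A : QueryAlg d T Ξ) (lam α t : ℝ) {k : ℕ}
    {y : Ξ → Matrix (Fin d) (Fin d) ℝ → EuclideanSpace ℝ (Fin d)} (hy : A.Revealed k y)
    (u : EuclideanSpace ℝ (Fin d)) (hu : ‖u‖ = 1) (ξ : Ξ) :
    2 * (1 + α * (goe d).real {W | t ≤ overlap lam y ((u, ξ), W)} -
        lam ^ 2 / 2 * ∑ i ∈ Finset.range k,
          ∫ W, overlap lam (fun ξ M => A.dir ξ M i) ((u, ξ), W) ∂goe d - Real.log 2) ≤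
      1 + (Real.exp α - 1) *
        (goe d).real {W | t ≤ d * (inner ℝ (y ξ ((1 / Real.sqrt d) • W)) u) ^ 2} := by
  set s := 1 / Real.sqrt d with hs
  have hu' : u.ofLp ⬝ᵥ u.ofLp = 1 := by
    rw [← EuclideanSpace.inner_eq_dotProduct, real_inner_self_eq_norm_sq, hu, one_pow]
  have hsm : Measurable fun N : Matrix (Fin d) (Fin d) ℝ => s • N :=
    measurable_const.matrix_smul measurable_id
  have hyξ : Measurable fun N : Matrix (Fin d) (Fin d) ℝ => y ξ (s • N) :=
    hy.measurable.comp (measurable_const.prodMk hsm)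
  have hE : MeasurableSet {N : Matrix (Fin d) (Fin d) ℝ |
      t ≤ d * (inner ℝ (y ξ (s • N)) u) ^ 2} :=
    measurableSet_le measurable_const
      (((hyξ.inner measurable_const).pow_const 2).const_mul _)
  have h := (A.isAdaptiveProj_unrevealed s ξ).fano k (lam * Real.sqrt d) u.ofLp hu' hE
    (fun M Y => by
      simp only [Set.mem_ofPred_eq]
      rw [hy.congr ξ _ _ (A.agree_unrevealed s ξ k M Y)]) α
  have hd2 : (lam * Real.sqrt d) ^ 2 / 2 = lam ^ 2 / 2 * d := by
    rw [mul_pow, Real.sq_sqrt (Nat.cast_nonneg d)]; ring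
  have hsum : (lam * Real.sqrt d) ^ 2 / 2 * ∫ W, (1 - u.ofLp ⬝ᵥ (A.unrevealed s ξ k
      ((lam * Real.sqrt d) • Matrix.vecMulVec u.ofLp u.ofLp + W)).mulVec u.ofLp) ∂goe d =
      lam ^ 2 / 2 * ∑ i ∈ Finset.range k,
          ∫ W, overlap lam (fun ξ M => A.dir ξ M i) ((u, ξ), W) ∂goe d := by
    rw [hd2, mul_assoc, ← integral_const_mul, ← integral_finsetSum]
    · congr 2
      funext W
      rw [unrevealed, dotProduct_complProj_mulVec, hu', sub_sub_cancel, Finset.mul_sum]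
      refine Finset.sum_congr rfl fun i _ => ?_
      rw [overlap, observed, EuclideanSpace.inner_eq_dotProduct]
    · intro i _
      have hm : Measurable fun W => overlap lam (fun ξ M => A.dir ξ M i) ((u, ξ), W) :=
        (measurable_overlap lam (A.measurable_dir i)).comp measurable_prodMk_left
      refine Integrable.of_bound hm.aestronglyMeasurable d
        (Filter.Eventually.of_forall fun W => ?_)
      rw [Real.norm_eq_abs, abs_of_nonneg (overlap_nonneg lam _)]
      exact mul_inner_sq_le (A.norm_dir_le _ _ _) hu
  rw [hsum] at h
  exact h

theorem _root_.integral_affine_le_of_ae {X : Type*} [MeasurableSpace X] {μ : Measure X}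
    [IsProbabilityMeasure μ] {f h : X → ℝ} {ι : Type*} {s : Finset ι} {g : ι → X → ℝ}
    {α β γ l : ℝ} (hf : Integrable f μ) (hg : ∀ i, Integrable (g i) μ) (hh : Integrable h μ)
    (hle : ∀ᵐ x ∂μ, 2 * (1 + α * f x - β * ∑ i ∈ s, g i x - l) ≤ 1 + γ * h x) :
    2 * (1 + α * ∫ x, f x ∂μ - β * ∑ i ∈ s, ∫ x, g i x ∂μ - l) ≤ 1 + γ * ∫ x, h x ∂μ := by
  have hs : Integrable (fun x => ∑ i ∈ s, g i x) μ := integrable_finsetSum s fun i _ => hg i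
  have i1 : Integrable (fun x => 1 + α * f x) μ := (integrable_const 1).add (hf.const_mul α)
  have i2 : Integrable (fun x => 1 + α * f x - β * ∑ i ∈ s, g i x) μ := i1.sub (hs.const_mul β)
  have i3 : Integrable (fun x => 1 + α * f x - β * ∑ i ∈ s, g i x - l) μ :=
    i2.sub (integrable_const l)
  have i4 : Integrable (fun x => 1 + γ * h x) μ := (integrable_const 1).add (hh.const_mul γ)
  have hm := integral_mono_ae (i3.const_mul 2) i4 hle
  rw [integral_const_mul, integral_sub i2 (integrable_const l), integral_sub i1 (hs.const_mul β),
    integral_add (integrable_const 1) (hf.const_mul α),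
    integral_add (integrable_const 1) (hh.const_mul γ), integral_const_mul, integral_const_mul,
    integral_const_mul, integral_finsetSum _ fun i _ => hg i] at hm
  simpa using hm

theorem tail_le (A : QueryAlg d T Ξ) {C₁ C₂ lam : ℝ} (hC₁ : 0 < C₁) (hC₂ : 0 < C₂)
    {P : Measure (EuclideanSpace ℝ (Fin d))} (hP : IsotropicTailPrior d C₁ C₂ P)
    (ν : Measure Ξ) [IsProbabilityMeasure ν] {k : ℕ}
    {y : Ξ → Matrix (Fin d) (Fin d) ℝ → EuclideanSpace ℝ (Fin d)} (hy : A.Revealed k y)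
    {t : ℝ} (ht : C₂ / C₁ < t) :
    (jointLaw P ν).real {q | t ≤ overlap lam y q} ≤ A.dirInfo lam P ν k / (C₁ * t - C₂) := by
  have hPp := hP.isProbabilityMeasure
  have hd := hP.pos
  have hP1 := hP.ae_norm_eq_one
  have ht0 : 0 < t := (div_pos hC₂ hC₁).trans ht
  -- This α makes exp(α) times the null tail bound equal to one, so the averaged right-hand side of
  -- Fano's inequality is at most 2 and leaves α·p ≤ log 2 + information.
  set α := C₁ * t - C₂ with hα
  have hα0 : 0 < α := by
    rw [div_lt_iff₀ hC₁] at ht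
    linarith
  have hS : MeasurableSet {q | t ≤ overlap lam y q} :=
    measurableSet_le measurable_const (measurable_overlap lam hy.measurable)
  have hiS : Integrable (Set.indicator {q | t ≤ overlap lam y q} (fun _ => (1 : ℝ))) (jointLaw P ν) :=
    (integrable_const (1 : ℝ)).indicator hS
  have e1 : ∀ x : EuclideanSpace ℝ (Fin d) × Ξ,
      (goe d).real {W | t ≤ overlap lam y (x, W)} =
        ∫ W, Set.indicator {q | t ≤ overlap lam y q} (fun _ => (1 : ℝ)) (x, W) ∂goe d := fun x => by
    have : ∀ W, Set.indicator {q | t ≤ overlap lam y q} (fun _ => (1 : ℝ)) (x, W) =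
        Set.indicator {W | t ≤ overlap lam y (x, W)} (fun _ => (1 : ℝ)) W := fun W => rfl
    simp only [this]
    have hSx : MeasurableSet {W | t ≤ overlap lam y (x, W)} :=
      measurable_prodMk_left (x := x) hS
    rw [integral_indicator_const_one hSx]
  have hi1 : Integrable (fun x => (goe d).real {W | t ≤ overlap lam y (x, W)}) (P.prod ν) := by
    simp only [e1]
    exact hiS.integral_prod_left
  have hint1 : ∫ x, (goe d).real {W | t ≤ overlap lam y (x, W)} ∂(P.prod ν) =
      (jointLaw P ν).real {q | t ≤ overlap lam y q} := by
    simp only [e1]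
    rw [← integral_indicator_const_one hS]
    exact (integral_prod _ hiS).symm
  have hio : ∀ i, Integrable (overlap lam fun ξ M => A.dir ξ M i) ((P.prod ν).prod (goe d)) :=
    fun i => integrable_overlap ν hP1 lam (A.measurable_dir i) fun ξ M => A.norm_dir_le ξ M i
  have hi2 : ∀ i, Integrable (fun x : EuclideanSpace ℝ (Fin d) × Ξ =>
      ∫ W, overlap lam (fun ξ M => A.dir ξ M i) (x, W) ∂goe d) (P.prod ν) := fun i =>
    (hio i).integral_prod_left
  have hint2 : ∀ i, ∫ x, ∫ W, overlap lam (fun ξ M => A.dir ξ M i) (x, W) ∂goe d ∂(P.prod ν) =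
      ∫ q, overlap lam (fun ξ M => A.dir ξ M i) q ∂jointLaw P ν := fun i => by
    rw [jointLaw, integral_prod _ (hio i)]
  have hsm0 : Measurable fun p : Ξ × Matrix (Fin d) (Fin d) ℝ =>
      (p.1, (1 / Real.sqrt d) • p.2) :=
    measurable_fst.prodMk (measurable_const.matrix_smul measurable_snd)
  have hsm : Measurable fun p : Ξ × Matrix (Fin d) (Fin d) ℝ =>
      y p.1 ((1 / Real.sqrt d) • p.2) :=
    hy.measurable.comp hsm0
  have hnull := hP.null_tail_le ν (y := fun ξ W => y ξ ((1 / Real.sqrt d) • W)) hsm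
    (fun ξ M => hy.norm_le ξ _) ht0
  have hm3 := measurable_mul_inner_sq (y := fun ξ W => y ξ ((1 / Real.sqrt d) • W)) hsm
  have hS3 : MeasurableSet {q : (EuclideanSpace ℝ (Fin d) × Ξ) × Matrix (Fin d) (Fin d) ℝ |
      t ≤ d * (inner ℝ (y q.1.2 ((1 / Real.sqrt d) • q.2)) q.1.1) ^ 2} :=
    measurableSet_le measurable_const hm3
  have hi3 : Integrable (fun x : EuclideanSpace ℝ (Fin d) × Ξ => (goe d).real
      {W | t ≤ d * (inner ℝ (y x.2 ((1 / Real.sqrt d) • W)) x.1) ^ 2}) (P.prod ν) :=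
    Integrable.of_bound (measurable_measure_prodMk_left hS3).ennreal_toReal.aestronglyMeasurable 1
      (Filter.Eventually.of_forall fun x => by
        rw [Real.norm_eq_abs, abs_of_nonneg measureReal_nonneg]
        exact measureReal_le_one)
  have hae : ∀ᵐ x ∂(P.prod ν), ‖x.1‖ = 1 :=
    (Measure.quasiMeasurePreserving_fst (μ := P) (ν := ν)).ae hP1
  have hmono := integral_affine_le_of_ae (s := Finset.range k) hi1 hi2 hi3
    (hae.mono fun x hx => A.fano lam α t hy x.1 hx x.2)
  simp only [hint1, hint2] at hmono
  have hexp : (Real.exp α - 1) * ∫ x : EuclideanSpace ℝ (Fin d) × Ξ, (goe d).real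
      {W | t ≤ d * (inner ℝ (y x.2 ((1 / Real.sqrt d) • W)) x.1) ^ 2} ∂(P.prod ν) ≤ 1 := by
    have h1 : 0 ≤ Real.exp α - 1 := by
      have := Real.add_one_le_exp α; linarith
    calc _ ≤ (Real.exp α - 1) * Real.exp (C₂ - C₁ * t) := mul_le_mul_of_nonneg_left hnull h1
      _ = 1 - Real.exp (-α) := by
        rw [sub_mul, one_mul, ← Real.exp_add, hα]; ring_nf; simp
      _ ≤ 1 := by have := Real.exp_pos (-α); linarith
  rw [le_div_iff₀ hα0, dirInfo]
  linarith

end QueryAlg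

/-! ### The recursion for the expected overlaps -/

/-- The range is split at s = C₂/C₁ + x/C₁, where the tail bound x/(C₁t - C₂) equals 1. Below s the
trivial bound gives the length s; above it the primitive is a logarithm. -/
theorem integral_le_of_tail_le {φ : ℝ → ℝ} (hφ : Antitone φ) (hφ1 : ∀ t, φ t ≤ 1)
    {C₁ C₂ x d : ℝ} (hC₁ : 0 < C₁) (hC₂ : 0 < C₂) (hx : 0 < x) (hd : 0 < d)
    (htail : ∀ t, C₂ / C₁ < t → φ t ≤ x / (C₁ * t - C₂)) :
    ∫ t in (0 : ℝ)..d, φ t ≤ C₂ / C₁ + x / C₁ * (1 + max 0 (Real.log (C₁ * d / x))) := by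
  have hint : ∀ a b, IntervalIntegrable φ volume a b := fun a b =>
    (hφ.antitoneOn _).intervalIntegrable
  have hone : ∀ b, 0 ≤ b → ∫ t in (0 : ℝ)..b, φ t ≤ b := fun b hb => by
    have := intervalIntegral.integral_mono_on hb (hint 0 b)
      (intervalIntegrable_const (c := (1 : ℝ))) fun t _ => hφ1 t
    simpa using this
  have hxC : 0 < x / C₁ := div_pos hx hC₁
  have hD : 0 < C₂ / C₁ := div_pos hC₂ hC₁
  set s := C₂ / C₁ + x / C₁ with hs
  have hs0 : 0 ≤ s := by positivity
  have hmax : 0 ≤ x / C₁ * max 0 (Real.log (C₁ * d / x)) :=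
    mul_nonneg hxC.le (le_max_left _ _)
  rcases le_total d s with h | h
  · have := hone d hd.le
    rw [mul_add, mul_one]
    linarith
  · have hpos : ∀ t ∈ Set.Icc s d, 0 < C₁ * t - C₂ := fun t ht => by
      have h1 : C₁ * s ≤ C₁ * t := mul_le_mul_of_nonneg_left ht.1 hC₁.le
      have h2 : C₁ * s = C₂ + x := by rw [hs]; field_simp
      linarith
    have hderiv : ∀ t ∈ Set.uIcc s d, HasDerivAt (fun t => x / C₁ * Real.log (C₁ * t - C₂))
        (x / (C₁ * t - C₂)) t := fun t ht => by
      rw [Set.uIcc_of_le h] at ht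
      have h1 : HasDerivAt (fun t => C₁ * t - C₂) C₁ t := by
        simpa using ((hasDerivAt_id t).const_mul C₁).sub_const C₂
      have h2 := (h1.log (hpos t ht).ne').const_mul (x / C₁)
      have h3 : x / C₁ * (C₁ / (C₁ * t - C₂)) = x / (C₁ * t - C₂) := by
        rw [div_mul_div_comm, mul_comm x, mul_div_mul_left _ _ hC₁.ne']
      rwa [h3] at h2
    have hcont : ContinuousOn (fun t => x / (C₁ * t - C₂)) (Set.uIcc s d) := by
      rw [Set.uIcc_of_le h]
      exact continuousOn_const.div (by fun_prop) fun t ht => (hpos t ht).ne'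
    have hFTC := intervalIntegral.integral_eq_sub_of_hasDerivAt hderiv hcont.intervalIntegrable
    have hle := intervalIntegral.integral_mono_on h (hint s d) hcont.intervalIntegrable
      fun t ht => htail t (by have := ht.1; linarith)
    rw [← intervalIntegral.integral_add_adjacent_intervals (hint 0 s) (hint s d)]
    have h1 := hone s hs0
    have h2 : C₁ * s - C₂ = x := by rw [hs]; field_simp; ring
    have hd' := hpos d ⟨h, le_rfl⟩
    have h3 : Real.log (C₁ * d - C₂) - Real.log x ≤ max 0 (Real.log (C₁ * d / x)) := by
      refine le_trans ?_ (le_max_right _ _)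
      rw [← Real.log_div hd'.ne' hx.ne']
      refine Real.log_le_log (div_pos hd' hx) ?_
      gcongr
      linarith
    have h4 : ∫ t in s..d, φ t ≤ x / C₁ * max 0 (Real.log (C₁ * d / x)) := by
      refine hle.trans ?_
      rw [hFTC, h2, ← mul_sub]
      exact mul_le_mul_of_nonneg_left h3 hxC.le
    rw [mul_add, mul_one]
    linarith

section

variable {d : ℕ} {Ξ : Type*} [MeasurableSpace Ξ] {P : Measure (EuclideanSpace ℝ (Fin d))}
  (ν : Measure Ξ) [IsProbabilityMeasure ν]
  {y : Ξ → Matrix (Fin d) (Fin d) ℝ → EuclideanSpace ℝ (Fin d)}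

theorem tail_eq_zero (hP : ∀ᵐ u ∂P, ‖u‖ = 1) (lam : ℝ) (hy1 : ∀ ξ M, ‖y ξ M‖ ≤ 1) {t : ℝ}
    (ht : d < t) : (jointLaw P ν).real {q | t ≤ overlap lam y q} = 0 := by
  have : jointLaw P ν {q | t ≤ overlap lam y q} = 0 := by
    refine measure_mono_null (t := {q | ¬ overlap lam y q ≤ d}) (fun q hq => ?_)
      (ae_iff.1 (overlap_le_ae ν hP lam hy1))
    exact not_le.2 (ht.trans_le hq)
  rw [Measure.real, this, ENNReal.toReal_zero]

theorem integral_overlap_eq [IsProbabilityMeasure P] (hP : ∀ᵐ u ∂P, ‖u‖ = 1) (lam : ℝ)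
    (hy : Measurable fun p : Ξ × Matrix (Fin d) (Fin d) ℝ => y p.1 p.2)
    (hy1 : ∀ ξ M, ‖y ξ M‖ ≤ 1) :
    ∫ q, overlap lam y q ∂jointLaw P ν =
      ∫ t in (0 : ℝ)..d, (jointLaw P ν).real {q | t ≤ overlap lam y q} := by
  rw [(integrable_overlap ν hP lam hy hy1).integral_eq_integral_meas_le
    (Filter.Eventually.of_forall fun q => overlap_nonneg lam q),
    intervalIntegral.integral_of_le (Nat.cast_nonneg d)]
  refine setIntegral_eq_of_subset_of_forall_sdiff_eq_zero measurableSet_Ioi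
    Set.Ioc_subset_Ioi_self fun t ht => ?_
  refine tail_eq_zero ν hP lam hy1 ?_
  by_contra h
  exact ht.2 ⟨ht.1, not_lt.1 h⟩

end

theorem integral_overlap_nonneg {d : ℕ} {Ξ : Type*} [MeasurableSpace Ξ]
    {P : Measure (EuclideanSpace ℝ (Fin d))} (ν : Measure Ξ)
    {y : Ξ → Matrix (Fin d) (Fin d) ℝ → EuclideanSpace ℝ (Fin d)} (lam : ℝ) :
    0 ≤ ∫ q, overlap lam y q ∂jointLaw P ν :=
  integral_nonneg fun q => overlap_nonneg lam q

namespace QueryAlg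

variable {d T : ℕ} {Ξ : Type*} [MeasurableSpace Ξ] (A : QueryAlg d T Ξ) {C₁ C₂ lam : ℝ}
  {P : Measure (EuclideanSpace ℝ (Fin d))}

theorem dirInfo_pos (ν : Measure Ξ) (k : ℕ) : 0 < A.dirInfo lam P ν k := by
  have h1 : 0 < Real.log 2 := Real.log_pos one_lt_two
  have h2 : 0 ≤ lam ^ 2 / 2 * ∑ i ∈ Finset.range k,
      ∫ q, overlap lam (fun ξ M => A.dir ξ M i) q ∂jointLaw P ν :=
    mul_nonneg (by positivity) (Finset.sum_nonneg fun i _ => integral_overlap_nonneg ν lam)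
  unfold dirInfo
  linarith

/-- Any x above the information is allowed: enlarging x is harmless already in the tail bound,
before integration. So one statement serves both `dirInfo` and `infoBound`. -/
theorem integral_overlap_le (hC₁ : 0 < C₁) (hC₂ : 0 < C₂) (hP : IsotropicTailPrior d C₁ C₂ P)
    (ν : Measure Ξ) [IsProbabilityMeasure ν] {k : ℕ}
    {y : Ξ → Matrix (Fin d) (Fin d) ℝ → EuclideanSpace ℝ (Fin d)} (hy : A.Revealed k y)
    {x : ℝ} (hx : A.dirInfo lam P ν k ≤ x) :
    ∫ q, overlap lam y q ∂jointLaw P ν ≤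
      C₂ / C₁ + x / C₁ * (1 + max 0 (Real.log (C₁ * d / x))) := by
  have := hP.isProbabilityMeasure
  rw [integral_overlap_eq ν hP.ae_norm_eq_one lam hy.measurable hy.norm_le]
  have hanti : Antitone fun t => (jointLaw P ν).real {q | t ≤ overlap lam y q} :=
    fun s t hst => measureReal_mono (fun q hq => le_trans hst hq) (measure_ne_top _ _)
  refine integral_le_of_tail_le hanti
    (fun t => measureReal_le_one) hC₁ hC₂ ((A.dirInfo_pos ν k).trans_le hx)
    (Nat.cast_pos.2 hP.pos) fun t ht => ?_
  refine (A.tail_le hC₁ hC₂ hP ν hy ht).trans ?_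
  have : 0 ≤ C₁ * t - C₂ := by
    rw [div_lt_iff₀ hC₁] at ht
    linarith
  gcongr

theorem tau_eq_dir (hA : A.OrthonormalQueries) (ν : Measure Ξ) [IsProbabilityMeasure ν]
    (hP : IsotropicTailPrior d C₁ C₂ P) {i : ℕ} (hi : i < T) :
    A.tau lam P ν i = ∫ q, overlap lam (fun ξ M => A.dir ξ M i) q ∂jointLaw P ν := by
  have := hP.isProbabilityMeasure
  rw [← integral_mul_inner_sq_eq ν hP.pos hP.ae_norm_eq_one lam (A.measurable_dir i)
    fun ξ M => A.norm_dir_le ξ M i, tau]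
  congr 1
  funext u
  have := isProbabilityMeasure_spikedLaw hP.pos lam u
  refine integral_congr_ae ?_
  filter_upwards [(Measure.quasiMeasurePreserving_fst (μ := spikedLaw d lam u) (ν := ν)).ae
    (isSymm_ae_spikedLaw lam u)] with p hp
  rw [dir_eq_vec hA p.2 hp hi]

theorem tailProb_eq_dir (hA : A.OrthonormalQueries) (ν : Measure Ξ) [IsProbabilityMeasure ν]
    (hP : IsotropicTailPrior d C₁ C₂ P) {i : ℕ} (hi : i < T) (t : ℝ) :
    A.tailProb lam P ν i t =
      (jointLaw P ν).real {q | t ≤ overlap lam (fun ξ M => A.dir ξ M i) q} := by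
  have := hP.isProbabilityMeasure
  rw [← integral_tail_eq ν hP.pos hP.ae_norm_eq_one lam t (A.measurable_dir i), tailProb]
  congr 1
  funext u
  have := isProbabilityMeasure_spikedLaw hP.pos lam u
  refine measureReal_congr ?_
  filter_upwards [(Measure.quasiMeasurePreserving_fst (μ := spikedLaw d lam u) (ν := ν)).ae
    (isSymm_ae_spikedLaw lam u)] with p hp
  refine propext ?_
  change t ≤ _ ↔ t ≤ _
  rw [dir_eq_vec hA p.2 hp hi]

theorem tau_eq_output (ν : Measure Ξ) [IsProbabilityMeasure ν]
    (hP : IsotropicTailPrior d C₁ C₂ P) :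
    A.tau lam P ν T = ∫ q, overlap lam (fun ξ M => A.vec ξ M T) q ∂jointLaw P ν := by
  have := hP.isProbabilityMeasure
  have h := integral_mul_inner_sq_eq (y := fun ξ M => A.vec ξ M T) ν hP.pos hP.ae_norm_eq_one
    lam (A.measurable_vec T) A.revealed_output.norm_le
  exact h

theorem tailProb_eq_output (ν : Measure Ξ) [IsProbabilityMeasure ν]
    (hP : IsotropicTailPrior d C₁ C₂ P) (t : ℝ) :
    A.tailProb lam P ν T t =
      (jointLaw P ν).real {q | t ≤ overlap lam (fun ξ M => A.vec ξ M T) q} := by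
  have := hP.isProbabilityMeasure
  have h := integral_tail_eq (y := fun ξ M => A.vec ξ M T) ν hP.pos hP.ae_norm_eq_one lam t
    (A.measurable_vec T)
  exact h

/-- For orthonormal queries, every `vec k` with `k ≤ T` behaves like a vector revealed by the first
`k` queries. -/
theorem exists_revealed (hA : A.OrthonormalQueries) (lam : ℝ) (ν : Measure Ξ)
    [IsProbabilityMeasure ν] (hP : IsotropicTailPrior d C₁ C₂ P) {k : ℕ} (hk : k ≤ T) :
    ∃ y, A.Revealed k y ∧ A.tau lam P ν k = ∫ q, overlap lam y q ∂jointLaw P ν ∧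
      ∀ t, A.tailProb lam P ν k t = (jointLaw P ν).real {q | t ≤ overlap lam y q} := by
  rcases hk.lt_or_eq with h | rfl
  · exact ⟨_, A.revealed_dir k, A.tau_eq_dir hA ν hP h, A.tailProb_eq_dir hA ν hP h⟩
  · exact ⟨_, A.revealed_output, A.tau_eq_output ν hP, A.tailProb_eq_output ν hP⟩

/-- The projection argument costs only the sum of the overlaps, so the summand k in `infoBound` is
slack. -/
theorem dirInfo_le_infoBound (hA : A.OrthonormalQueries) (ν : Measure Ξ) [IsProbabilityMeasure ν]
    (hP : IsotropicTailPrior d C₁ C₂ P) {k : ℕ} (hk : k ≤ T) :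
    A.dirInfo lam P ν k ≤ infoBound A lam P ν k := by
  unfold dirInfo infoBound
  have : ∑ i ∈ Finset.range k, A.tau lam P ν i = ∑ i ∈ Finset.range k,
      ∫ q, overlap lam (fun ξ M => A.dir ξ M i) q ∂jointLaw P ν :=
    Finset.sum_congr rfl fun i hi =>
      A.tau_eq_dir hA ν hP ((Finset.mem_range.1 hi).trans_le hk)
  rw [this]
  gcongr
  linarith [(Nat.cast_nonneg k : (0 : ℝ) ≤ k)]

theorem tailProb_le (hC₁ : 0 < C₁) (hC₂ : 0 < C₂) (hP : IsotropicTailPrior d C₁ C₂ P)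
    (ν : Measure Ξ) [IsProbabilityMeasure ν] (hA : A.OrthonormalQueries) {k : ℕ} (hk : k ≤ T)
    {t : ℝ} (ht : C₂ / C₁ < t) : A.tailProb lam P ν k t ≤
      if t ≤ d then min 1 (infoBound A lam P ν k / (C₁ * t - C₂)) else 0 := by
  have := hP.isProbabilityMeasure
  obtain ⟨y, hy, -, h⟩ := A.exists_revealed hA lam ν hP hk
  rw [h]
  split_ifs with htd
  · refine le_min measureReal_le_one ((A.tail_le hC₁ hC₂ hP ν hy ht).trans ?_)
    have : 0 ≤ C₁ * t - C₂ := by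
      rw [div_lt_iff₀ hC₁] at ht
      linarith
    have := A.dirInfo_le_infoBound (lam := lam) hA ν hP hk
    gcongr
  · exact (tail_eq_zero ν hP.ae_norm_eq_one lam hy.norm_le (not_le.1 htd)).le

theorem tau_le (hC₁ : 0 < C₁) (hC₂ : 0 < C₂) (hP : IsotropicTailPrior d C₁ C₂ P)
    (ν : Measure Ξ) [IsProbabilityMeasure ν] (hA : A.OrthonormalQueries) {k : ℕ} (hk : k ≤ T) :
    A.tau lam P ν k ≤ C₂ / C₁ + infoBound A lam P ν k / C₁ *
      (1 + max 0 (Real.log (C₁ * d / infoBound A lam P ν k))) := by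
  obtain ⟨y, hy, h, -⟩ := A.exists_revealed hA lam ν hP hk
  rw [h]
  exact A.integral_overlap_le hC₁ hC₂ hP ν hy (A.dirInfo_le_infoBound hA ν hP hk)

end QueryAlg

/-! ### Growth of the recursion -/

/-- The solution of the recursion after `T ≤ c log d / log log d` steps is `o(d)`. -/
theorem eventually_pow_le (K c ε : ℝ) (hK : 1 ≤ K) (hc : c < 1) (hε : 0 < ε) :
    ∀ᶠ d : ℕ in Filter.atTop, 1 ≤ Real.log d ∧ ∀ T : ℕ,
      (T : ℝ) ≤ c * (Real.log d / Real.log (Real.log d)) →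
        (K * Real.log d) ^ (T + 1) ≤ ε * d := by
  -- After taking logarithms the slack (1 - c) log d pays three errors: T log K, log log d, and log
  -- K - log ε.
  set γ := (1 - c) / 3 with hγ
  have hγ0 : 0 < γ := by rw [hγ]; linarith
  have hlogd : Filter.Tendsto (fun d : ℕ => Real.log d) Filter.atTop Filter.atTop :=
    Real.tendsto_log_atTop.comp tendsto_natCast_atTop_atTop
  have e1 : ∀ᶠ L : ℝ in Filter.atTop, Real.log L ≤ γ * L := by
    have := Real.isLittleO_log_id_atTop.bound hγ0
    filter_upwards [this, Filter.eventually_ge_atTop 1] with L hL h1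
    rw [id, Real.norm_eq_abs, Real.norm_eq_abs, abs_of_nonneg (by linarith : (0 : ℝ) ≤ L)] at hL
    exact (le_abs_self _).trans hL
  have e2 : ∀ᶠ L : ℝ in Filter.atTop, max 1 (Real.log K / γ) ≤ Real.log L :=
    Real.tendsto_log_atTop.eventually_ge_atTop _
  have e3 : ∀ᶠ L : ℝ in Filter.atTop, max 1 ((Real.log K - Real.log ε) / γ) ≤ L :=
    Filter.eventually_ge_atTop _
  filter_upwards [hlogd.eventually e1, hlogd.eventually e2, hlogd.eventually e3,
    Filter.eventually_gt_atTop 0] with d h1 h2 h3 hd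
  have hd' : (0 : ℝ) < d := Nat.cast_pos.2 hd
  set L := Real.log d with hL
  have hL1 : 1 ≤ L := (le_max_left _ _).trans h3
  refine ⟨hL1, fun T hT => ?_⟩
  have hLL : 1 ≤ Real.log L := (le_max_left _ _).trans h2
  have hLK : Real.log K ≤ γ * Real.log L := by
    have := (le_max_right _ _).trans h2
    rwa [div_le_iff₀ hγ0, mul_comm] at this
  have h3' : Real.log K - Real.log ε ≤ γ * L := by
    have := (le_max_right _ _).trans h3
    rwa [div_le_iff₀ hγ0, mul_comm] at this
  have hK0 : 0 ≤ Real.log K := Real.log_nonneg hK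
  have hKL : 0 < K * L := by positivity
  rw [← Real.log_le_log_iff (by positivity) (by positivity), Real.log_pow,
    Real.log_mul (by positivity) (by positivity), Real.log_mul hε.ne' hd'.ne', ← hL]
  push_cast
  have hT2 : (T : ℝ) * Real.log L ≤ c * L := by
    rw [← mul_div_assoc] at hT
    exact (le_div_iff₀ (by linarith)).1 hT
  have hT3 : (T : ℝ) * Real.log K ≤ γ * L := by
    have hTnn : (0 : ℝ) ≤ T := Nat.cast_nonneg T
    have := mul_le_mul_of_nonneg_left hLK hTnn
    have h4 : γ * (T * Real.log L) ≤ γ * (c * L) := mul_le_mul_of_nonneg_left hT2 hγ0.le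
    have h5 : c * L ≤ 1 * L := mul_le_mul_of_nonneg_right hc.le (by linarith)
    have h6 : γ * (c * L) ≤ γ * (1 * L) := mul_le_mul_of_nonneg_left h5 hγ0.le
    linarith
  have h7 : c * L + 3 * (γ * L) = L := by rw [hγ]; ring
  linarith

/-- Stated for bare sequences, so that it applies both to orthonormal queries and to the
Gram–Schmidt directions of arbitrary ones. As x ≥ log 2 > 1/2, the constant C₂/C₁ and the logarithm
are absorbed into τ ≤ K₀ x log d, and x grows by a factor at most K log d per step, starting from
log 2 < 1. -/
theorem exists_forall_le_of_recursion {C₁ C₂ : ℝ} (lam : ℝ) (hC₁ : 0 < C₁) (hC₂ : 0 < C₂) {c : ℝ}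
    (hc : c < 1) {ε : ℝ} (hε : 0 < ε) :
    ∃ d₀ : ℕ, ∀ d : ℕ, d₀ ≤ d → ∀ T : ℕ, (T : ℝ) ≤ c * (Real.log d / Real.log (Real.log d)) →
      ∀ τ x : ℕ → ℝ, (∀ i, 0 ≤ τ i) →
        (∀ k, x k = Real.log 2 + lam ^ 2 / 2 * ∑ i ∈ Finset.range k, τ i) →
        (∀ k, k ≤ T →
          τ k ≤ C₂ / C₁ + x k / C₁ * (1 + max 0 (Real.log (C₁ * d / x k)))) →
        ∀ k, k ≤ T → τ k ≤ ε * d := by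
  set K₀ := 2 * (C₂ / C₁) + (2 + |Real.log (2 * C₁)|) / C₁ with hK₀
  set K := 1 + K₀ + lam ^ 2 / 2 * K₀ with hK
  have hK₀0 : 0 ≤ K₀ := by positivity
  have hlK : 0 ≤ lam ^ 2 / 2 * K₀ := by positivity
  have hK1 : 1 ≤ K := by rw [hK]; linarith
  obtain ⟨d₀, h₀⟩ := Filter.eventually_atTop.1 (eventually_pow_le K c ε hK1 hc hε)
  refine ⟨d₀, fun d hd T hT τ x hτ hx hrec k hk => ?_⟩
  obtain ⟨hL1, hpow⟩ := h₀ d hd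
  refine le_trans ?_ (hpow T hT)
  set L := Real.log d with hL
  have hd' : (0 : ℝ) < d := by
    rcases Nat.eq_zero_or_pos d with h | h
    · rw [h, Nat.cast_zero, Real.log_zero] at hL; linarith
    · exact Nat.cast_pos.2 h
  have hx2 : ∀ k, 1 / 2 ≤ x k := fun k => by
    have h1 : 0 ≤ lam ^ 2 / 2 * ∑ i ∈ Finset.range k, τ i :=
      mul_nonneg (by positivity) (Finset.sum_nonneg fun i _ => hτ i)
    have h2 := Real.log_two_gt_d9
    rw [hx]
    linarith
  have hstep : ∀ k, k ≤ T → τ k ≤ x k * (K₀ * L) := fun k hk => by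
    have hxk := hx2 k
    have hx0 : 0 < x k := by linarith
    have h1 : max 0 (Real.log (C₁ * d / x k)) ≤ |Real.log (2 * C₁)| + L := by
      refine max_le (by positivity) ?_
      have h2 : C₁ * d / x k ≤ 2 * C₁ * d := by
        rw [div_le_iff₀ hx0]
        have : 0 ≤ C₁ * d * (2 * x k - 1) := mul_nonneg (by positivity) (by linarith)
        linarith
      refine (Real.log_le_log (by positivity) h2).trans ?_
      rw [Real.log_mul (by positivity) hd'.ne']
      linarith [le_abs_self (Real.log (2 * C₁))]
    have h2 : 1 + max 0 (Real.log (C₁ * d / x k)) ≤ (2 + |Real.log (2 * C₁)|) * L := by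
      have := mul_nonneg (abs_nonneg (Real.log (2 * C₁))) (by linarith : 0 ≤ L - 1)
      linarith
    have h3 : C₂ / C₁ ≤ x k * (2 * (C₂ / C₁) * L) := by
      have h4 : 1 ≤ 2 * x k * L := by
        have := mul_le_mul (by linarith : (1 : ℝ) ≤ 2 * x k) hL1 zero_le_one (by linarith)
        linarith
      have := mul_le_mul_of_nonneg_left h4 (div_pos hC₂ hC₁).le
      linarith
    calc τ k ≤ C₂ / C₁ + x k / C₁ * (1 + max 0 (Real.log (C₁ * d / x k))) := hrec k hk
      _ ≤ x k * (2 * (C₂ / C₁) * L) + x k / C₁ * ((2 + |Real.log (2 * C₁)|) * L) := by gcongr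
      _ = x k * (K₀ * L) := by rw [hK₀]; ring
  have hx1 : ∀ k, k ≤ T → x k ≤ (K * L) ^ k := fun k => by
    induction k with
    | zero =>
      intro _
      have := Real.log_two_lt_d9
      rw [hx]
      simp
      linarith
    | succ k ih =>
      intro hk
      have hx0 : 0 < x k := by linarith [hx2 k]
      have h1 : x (k + 1) = x k + lam ^ 2 / 2 * τ k := by
        rw [hx, hx k, Finset.sum_range_succ]; ring
      have h2 : lam ^ 2 / 2 * τ k ≤ lam ^ 2 / 2 * (x k * (K₀ * L)) :=
        mul_le_mul_of_nonneg_left (hstep k (by omega)) (by positivity)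
      have h3 : x k ≤ x k * L := le_mul_of_one_le_right hx0.le hL1
      have h4 : 0 ≤ x k * (K₀ * L) := by positivity
      calc x (k + 1) ≤ x k * (K * L) := by rw [h1, hK]; linarith
        _ ≤ (K * L) ^ k * (K * L) := by
          gcongr
          exact ih (by omega)
        _ = (K * L) ^ (k + 1) := (pow_succ _ _).symm
  have hKL : 1 ≤ K * L := by
    have := mul_le_mul hK1 hL1 zero_le_one (by linarith)
    linarith
  calc τ k ≤ x k * (K₀ * L) := hstep k hk
    _ ≤ (K * L) ^ k * (K * L) := by
      have : K₀ ≤ K := by rw [hK]; linarith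
      gcongr
      exact hx1 k hk
    _ = (K * L) ^ (k + 1) := (pow_succ _ _).symm
    _ ≤ (K * L) ^ (T + 1) := pow_le_pow_right₀ hKL (by omega)

namespace QueryAlg

variable {d T : ℕ} {Ξ : Type*} [MeasurableSpace Ξ]

/-- The expected overlaps of the directions, followed by that of the output, satisfy the
recursion. -/
theorem recursion (A : QueryAlg d T Ξ) {C₁ C₂ lam : ℝ} (hC₁ : 0 < C₁) (hC₂ : 0 < C₂)
    {P : Measure (EuclideanSpace ℝ (Fin d))} (hP : IsotropicTailPrior d C₁ C₂ P)
    (ν : Measure Ξ) [IsProbabilityMeasure ν] : ∃ τ x : ℕ → ℝ, (∀ i, 0 ≤ τ i) ∧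
      (∀ k, x k = Real.log 2 + lam ^ 2 / 2 * ∑ i ∈ Finset.range k, τ i) ∧
      (∀ k, k ≤ T → τ k ≤ C₂ / C₁ + x k / C₁ * (1 + max 0 (Real.log (C₁ * d / x k)))) ∧
      (∀ k, k < T → τ k = ∫ q, overlap lam (fun ξ M => A.dir ξ M k) q ∂jointLaw P ν) ∧
      τ T = A.tau lam P ν T := by
  -- At k = T the sequence switches from directions to the raw output. This is harmless, since x k
  -- for k ≤ T sums only indices below T.
  let y : ℕ → Ξ → Matrix (Fin d) (Fin d) ℝ → EuclideanSpace ℝ (Fin d) := fun k =>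
    if k < T then fun ξ M => A.dir ξ M k else fun ξ M => A.vec ξ M T
  let τ : ℕ → ℝ := fun k => ∫ q, overlap lam (y k) q ∂jointLaw P ν
  have hlt : ∀ k, k < T → τ k = ∫ q, overlap lam (fun ξ M => A.dir ξ M k) q ∂jointLaw P ν :=
    fun k hk => by simp only [τ, y, if_pos hk]
  refine ⟨τ, fun k => Real.log 2 + lam ^ 2 / 2 * ∑ i ∈ Finset.range k, τ i,
    fun i => integral_overlap_nonneg ν lam, fun _ => rfl, fun k hk => ?_, hlt, ?_⟩
  · have hx : A.dirInfo lam P ν k = Real.log 2 + lam ^ 2 / 2 * ∑ i ∈ Finset.range k, τ i := by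
      rw [dirInfo, Finset.sum_congr rfl fun i hi =>
        (hlt i ((Finset.mem_range.1 hi).trans_le hk)).symm]
    have hy : A.Revealed k (y k) := by
      rcases hk.lt_or_eq with h | rfl
      · simp only [y, if_pos h]
        exact A.revealed_dir k
      · simp only [y, lt_irrefl, if_false]
        exact A.revealed_output
    exact A.integral_overlap_le hC₁ hC₂ hP ν hy hx.le
  · rw [A.tau_eq_output ν hP]
    simp only [τ, y, lt_irrefl, if_false]

/-- Markov's inequality for the scaled overlap of the output, at the threshold dη. -/
theorem successProb_le (A : QueryAlg d T Ξ) {C₁ C₂ lam : ℝ}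
    {P : Measure (EuclideanSpace ℝ (Fin d))} (hP : IsotropicTailPrior d C₁ C₂ P)
    (ν : Measure Ξ) [IsProbabilityMeasure ν] {η : ℝ} :
    d * η * A.successProb lam P ν η ≤ A.tau lam P ν T := by
  have := hP.isProbabilityMeasure
  have hd : (0 : ℝ) < d := Nat.cast_pos.2 hP.pos
  have h : A.successProb lam P ν η = A.tailProb lam P ν T (d * η) := by
    simp only [successProb, tailProb, output, mul_le_mul_iff_right₀ hd]
  rw [h, A.tailProb_eq_output ν hP, A.tau_eq_output ν hP]
  exact mul_meas_ge_le_integral_of_nonneg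
    (Filter.Eventually.of_forall fun q => overlap_nonneg lam q)
    (integrable_overlap ν hP.ae_norm_eq_one lam (A.measurable_vec T) A.revealed_output.norm_le) _

end QueryAlg

theorem mainTheorem11 (C₁ C₂ lam : ℝ) (hC₁ : 0 < C₁) (hC₂ : 0 < C₂) (hlam : 0 < lam) :
    -- the recursion, for orthonormal queries
    (∀ (d T : ℕ) (P : Measure (EuclideanSpace ℝ (Fin d))), IsotropicTailPrior d C₁ C₂ P →
      ∀ (Ξ : Type*) [MeasurableSpace Ξ] (ν : Measure Ξ) [IsProbabilityMeasure ν]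
        (A : QueryAlg d T Ξ), A.OrthonormalQueries → ∀ k : ℕ, 1 ≤ k → k ≤ T →
      (∀ t : ℝ, C₂ / C₁ < t →
        A.tailProb lam P ν k t ≤
          if t ≤ d then min 1 (infoBound A lam P ν k / (C₁ * t - C₂)) else 0) ∧
      A.tau lam P ν k ≤
        C₂ / C₁ + infoBound A lam P ν k / C₁ *
          (1 + max 0 (Real.log (C₁ * d / infoBound A lam P ν k)))) ∧
    -- `τ_{k+1} = o(d)` as long as `k ≤ T ≤ c log d / log log d`, for orthonormal queries
    (∀ c : ℝ, 0 < c → c < 1 → ∀ ε : ℝ, 0 < ε → ∃ d₀ : ℕ, ∀ d : ℕ, d₀ ≤ d →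
      ∀ (T : ℕ) (P : Measure (EuclideanSpace ℝ (Fin d))), IsotropicTailPrior d C₁ C₂ P →
      ∀ (Ξ : Type*) [MeasurableSpace Ξ] (ν : Measure Ξ) [IsProbabilityMeasure ν]
        (A : QueryAlg d T Ξ), A.OrthonormalQueries →
      (T : ℝ) ≤ c * (Real.log d / Real.log (Real.log d)) →
      ∀ k : ℕ, k ≤ T → A.tau lam P ν k ≤ ε * d) ∧
    -- the query lower bound, for arbitrary queries
    (∀ c : ℝ, 0 < c → c < 1 → ∀ η δ : ℝ, 0 < η → 0 < δ → ∃ d₀ : ℕ, ∀ d : ℕ, d₀ ≤ d →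
      ∀ (T : ℕ) (P : Measure (EuclideanSpace ℝ (Fin d))), IsotropicTailPrior d C₁ C₂ P →
      ∀ (Ξ : Type*) [MeasurableSpace Ξ] (ν : Measure Ξ) [IsProbabilityMeasure ν]
        (A : QueryAlg d T Ξ), δ ≤ A.successProb lam P ν η →
      c * (Real.log d / Real.log (Real.log d)) < T) := by
  refine ⟨fun d T P hP Ξ _ ν _ A hA k _ hk =>
    ⟨fun t ht => A.tailProb_le hC₁ hC₂ hP ν hA hk ht, A.tau_le hC₁ hC₂ hP ν hA hk⟩, ?_, ?_⟩
  · intro c _ hc ε hε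
    obtain ⟨d₀, h₀⟩ := exists_forall_le_of_recursion lam hC₁ hC₂ hc hε
    refine ⟨d₀, fun d hd T P hP Ξ _ ν _ A hA hT k hk => ?_⟩
    obtain ⟨τ, x, hτ, hx, hrec, hlt, hlast⟩ := A.recursion (lam := lam) hC₁ hC₂ hP ν
    have h := h₀ d hd T hT τ x hτ hx hrec k hk
    rcases hk.lt_or_eq with hk' | rfl
    · rwa [A.tau_eq_dir hA ν hP hk', ← hlt k hk']
    · rwa [← hlast]
  · intro c _ hc η δ hη hδ
    -- With ε = ηδ/2, success would force the expected output overlap to be at least dηδ, twice the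
    -- bound from the recursion.
    obtain ⟨d₀, h₀⟩ := exists_forall_le_of_recursion lam hC₁ hC₂ hc
      (show 0 < η * δ / 2 by positivity)
    refine ⟨d₀, fun d hd T P hP Ξ _ ν _ A hsucc => ?_⟩
    by_contra hT
    obtain ⟨τ, x, hτ, hx, hrec, -, hlast⟩ := A.recursion (lam := lam) hC₁ hC₂ hP ν
    have h := h₀ d hd T (not_lt.1 hT) τ x hτ hx hrec T le_rfl
    rw [hlast] at h
    have hd' : (0 : ℝ) < d := Nat.cast_pos.2 hP.pos
    have h1 : d * η * δ ≤ d * η * A.successProb lam P ν η :=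
      mul_le_mul_of_nonneg_left hsucc (by positivity)
    have h2 := A.successProb_le (lam := lam) hP ν (η := η)
    have h3 : 0 < d * η * δ := by positivity
    linarith
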